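/- A \emph{$D$-set} is a set $\Omega$ with a quaternary relation $D(wx;yz)$ such that for all $w,x,y,z\in\Omega$: (D1) $D(wx;yz)\to D(xw;yz)\wedge D(yz;wx)$; (D2) $D(wx;yz)\to\neg D(wy;xz)$; (D3) $D(wx;yz)\to\forall v\,(D(vx;yz)\vee D(wx;yv))$; (D4) $(w\ne y\wedge x\ne y)\to D(wx;yy)$. A \emph{node splitting} of $\Omega$ is a partition of $\Omega$ into at least three sets (\emph{sectors}) such that $D(ab;cd)$ holds whenever $a,b$ lie in one sector and $c,d$ lie outside it, and $D(ab;cd)$ fails whenever $a,b,c,d$ lie in four different sectors. Let $\Omega$ be a $D$-set, possibly expanded by a family of unary predicates (this includes pure $D$-sets and colored $D$-sets, in which finitely many nonempty predicates partition $\Omega$), regarded as a structure in the language consisting of $D$ and these predicates. Let $I$ be a linear order with no least and no greatest element. A sequence $s=(s_i)_{i\in I}$ of $n$-tuples is \emph{indiscernible} (over $B\subseteq\Omega$) if for every formula $\varphi$ (with parameters from $B$) and all $i_1<\dots<i_m$, $j_1<\dots<j_m$ in $I$ we have $\Omega\models\varphi(s_{i_1},\dots,s_{i_m})\leftrightarrow\varphi(s_{j_1},\dots,s_{j_m})$;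 it is \emph{weakly indiscernible} over $B$ if this holds for all quantifier-free formulas $\varphi$ with parameters from $B$. Every indiscernible sequence $a=(a_i)_{i\in I}$ of single elements is constant, or \emph{petaled} (the $a_i$ are distinct and $D$ holds on no four distinct $a_i$), or \emph{monotonic} (the $a_i$ are distinct and $D(a_ia_j;a_ka_\ell)$ for all $i<j<k<\ell$). Its \emph{discernible hull} $H(a)$ is defined as follows. If $a$ is constant, $H(a)=\emptyset$. If $a$ is petaled and not constant, $H(a)$ is the union of those sectors that contain elements of $a$, in the node splitting of $\Omega$ that extends the partition $\{\{a_i\}:i\in I\}$ of $\{a_i : i\in I\}$. If $a$ is monotonic and not constant, $H(a)$ is the union of $\{a_i:i\in I\}$ with \begin{align*} H_1(a)&=\{x:\ \exists i<j<k,\ D(a_ia_k;a_jx)\},\\ H_2(a)&=\{x:\ \exists i<j<k,\ \text{none of } D(a_ia_j;a_kx),\ D(a_ia_k;a_jx),\ D(a_ix;a_ja_k)\text{ holds}\},\\ H_3(a)&=\{x:\ \exists i<j<k<\ell,\ D(a_ix;a_ka_\ell)\text{ and }D(a_ia_j;xa_\ell)\}. \end{align*} For a sequence $s=(s^1,\dots,s^n)$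 of $n$-tuples, $H(s)=\bigcup_{k=1}^nH(s^k)$, where $s^k$ is the $k$-th component sequence. \textbf{Theorem.} Let $s=(s_i)_{i\in I}$ be an indiscernible sequence (over $\emptyset$) of $n$-tuples in $\Omega$, and let $B\subseteq\Omega$. Then $s$ is weakly indiscernible over $B$ if and only if $B\cap H(s)=\emptyset$. If, moreover, the complete theory of $\Omega$ has quantifier elimination, then $s$ is indiscernible over $B$ if and only if it is weakly indiscernible over $B$, and hence if and only if $B\cap H(s)=\emptyset$. -/

import Mathlib

open FirstOrder

namespace DSet

/-! ### `D`-relations, splittings and the discernible hull -/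

section Hull

variable {Ω : Type*}

/-- `D` is a `D`-relation on `Ω`: axioms (D1)-(D4). Here `D w x y z` stands for `D(wx;yz)`. -/
structure IsDRelation (D : Ω → Ω → Ω → Ω → Prop) : Prop where
  d1 : ∀ w x y z, D w x y z → D x w y z ∧ D y z w x
  d2 : ∀ w x y z, D w x y z → ¬ D w y x z
  d3 : ∀ w x y z, D w x y z → ∀ v, D v x y z ∨ D w x y v
  d4 : ∀ w x y, w ≠ y → x ≠ y → D w x y y

/-- `C` is a splitting of `Ω`: a partition into at least two sets (the sectors). -/
structure IsSplitting (D : Ω → Ω → Ω → Ω → Prop) (C : Set (Set Ω)) : Prop where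
  isPartition : Setoid.IsPartition C
  two_le : 2 ≤ C.encard
  same : ∀ S ∈ C, ∀ a ∈ S, ∀ b ∈ S, ∀ c ∉ S, ∀ d ∉ S, D a b c d
  different : ∀ S₁ ∈ C, ∀ S₂ ∈ C, ∀ S₃ ∈ C, ∀ S₄ ∈ C,
    S₁ ≠ S₂ → S₁ ≠ S₃ → S₁ ≠ S₄ → S₂ ≠ S₃ → S₂ ≠ S₄ → S₃ ≠ S₄ →
    ∀ a ∈ S₁, ∀ b ∈ S₂, ∀ c ∈ S₃, ∀ d ∈ S₄, ¬ D a b c d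

/-- A node splitting is a splitting into more than two sectors. -/
def IsNodeSplitting (D : Ω → Ω → Ω → Ω → Prop) (C : Set (Set Ω)) : Prop :=
  IsSplitting D C ∧ 2 < C.encard

variable {I : Type*}

/-- The sequence `a` is constant. -/
def IsConstant (a : I → Ω) : Prop := ∀ i j, a i = a j

/-- The elements of `a` are distinct and there are no nontrivial `D`-relations between them. -/
def IsPetaled (D : Ω → Ω → Ω → Ω → Prop) (a : I → Ω) : Prop :=
  Function.Injective a ∧
    ∀ i j k l, i ≠ j → i ≠ k → i ≠ l → j ≠ k → j ≠ l → k ≠ l → ¬ D (a i) (a j) (a k) (a l)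

/-- The elements of `a` are distinct and `D(a_i a_j; a_k a_l)` whenever `i < j < k < l`. -/
def IsMonotonic [LinearOrder I] (D : Ω → Ω → Ω → Ω → Prop) (a : I → Ω) : Prop :=
  Function.Injective a ∧ ∀ i j k l, i < j → j < k → k < l → D (a i) (a j) (a k) (a l)

/-- `C` extends the partition of the set of elements of `a` into singletons: every `{a i}` is the
intersection of a sector of `C` with the set of elements of `a`. -/
def Separates (C : Set (Set Ω)) (a : I → Ω) : Prop :=
  ∀ i, ∃ S ∈ C, S ∩ Set.range a = {a i}

/-- The union of the sectors containing elements of `a`, for a node splitting that extends the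
partition of `a` into singletons. (There is exactly one such node splitting if `a` is an infinite
petaled sequence in a `D`-set.) -/
def petaledHull (D : Ω → Ω → Ω → Ω → Prop) (a : I → Ω) : Set Ω :=
  {x | ∃ C, IsNodeSplitting D C ∧ Separates C a ∧ ∃ S ∈ C, x ∈ S ∧ ∃ i, a i ∈ S}

section Monotonic

variable [LinearOrder I]

def hull₁ (D : Ω → Ω → Ω → Ω → Prop) (a : I → Ω) : Set Ω :=
  {x | ∃ i j k, i < j ∧ j < k ∧ D (a i) (a k) (a j) x}

/-- There are `i < j < k` such that none of the three ways of pairing off `a i, a j, a k, x` gives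
a `D`-relation. -/
def hull₂ (D : Ω → Ω → Ω → Ω → Prop) (a : I → Ω) : Set Ω :=
  {x | ∃ i j k, i < j ∧ j < k ∧
    ¬ D (a i) (a j) (a k) x ∧ ¬ D (a i) (a k) (a j) x ∧ ¬ D (a i) x (a j) (a k)}

def hull₃ (D : Ω → Ω → Ω → Ω → Prop) (a : I → Ω) : Set Ω :=
  {x | ∃ i j k l, i < j ∧ j < k ∧ k < l ∧ D (a i) x (a k) (a l) ∧ D (a i) (a j) x (a l)}

def monotonicHull (D : Ω → Ω → Ω → Ω → Prop) (a : I → Ω) : Set Ω :=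
  Set.range a ∪ hull₁ D a ∪ hull₂ D a ∪ hull₃ D a

open Classical in
/-- The discernible hull of a sequence of singletons. An unbounded indiscernible sequence in a
`D`-set is constant, petaled or monotonic, so that for such sequences the last case, a junk value,
does not occur. -/
noncomputable def singleHull (D : Ω → Ω → Ω → Ω → Prop) (a : I → Ω) : Set Ω :=
  if IsConstant a then ∅
  else if IsPetaled D a then petaledHull D a
  else if IsMonotonic D a then monotonicHull D a
  else ∅

/-- The discernible hull of a sequence of `n`-tuples: the union of the discernible hulls of its
component sequences. -/
noncomputable def hull {n : ℕ} (D : Ω → Ω → Ω → Ω → Prop) (s : I → Fin n → Ω) : Set Ω :=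
  ⋃ k : Fin n, singleHull D (fun i => s i k)

end Monotonic

end Hull

/-! ### The language of `D`-sets with unary predicates -/

/-- Relation symbols: a 4-ary symbol `D` and a unary symbol for every `c : ι`. -/
inductive Rel (ι : Type*) : ℕ → Type _
  | D : Rel ι 4
  | color (c : ι) : Rel ι 1

/-- The language of `D`-sets with unary predicates indexed by `ι` (no predicates if `ι` is empty,
finitely many colors if `ι` is finite). -/
def lang (ι : Type*) : Language := ⟨fun _ => Empty, Rel ι⟩

/-- The interpretation of the symbol `D`. -/
def dRel (ι : Type*) {Ω : Type*} [(lang ι).Structure Ω] (w x y z : Ω) : Prop :=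
  Language.Structure.RelMap (L := lang ι) (M := Ω) (Rel.D : Rel ι 4) ![w, x, y, z]

/-! ### Indiscernibility and quantifier elimination -/

section ModelTheory

variable (L : Language) {M : Type*} [L.Structure M] {I : Type*} [LinearOrder I] {n : ℕ}

/-- (Order) indiscernible sequences of `n`-tuples. The variables of a formula are indexed by pairs
(position in the increasing sequence of indices, coordinate). -/
def Indiscernible (s : I → Fin n → M) : Prop :=
  ∀ (m : ℕ) (φ : L.Formula (Fin m × Fin n)) (i j : Fin m → I), StrictMono i → StrictMono j →
    (φ.Realize (fun p => s (i p.1) p.2) ↔ φ.Realize (fun p => s (j p.1) p.2))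

/-- Indiscernibility for quantifier-free formulas. -/
def QFIndiscernible (s : I → Fin n → M) : Prop :=
  ∀ (m : ℕ) (φ : L.Formula (Fin m × Fin n)), φ.IsQF →
    ∀ i j : Fin m → I, StrictMono i → StrictMono j →
    (φ.Realize (fun p => s (i p.1) p.2) ↔ φ.Realize (fun p => s (j p.1) p.2))

/-- Indiscernibility over `B`: for formulas with parameters from `B`. -/
def IndiscernibleOver (B : Set M) (s : I → Fin n → M) : Prop :=
  Indiscernible (L.withConstants B) s

/-- Weak indiscernibility over `B`: for quantifier-free formulas with parameters from `B`. -/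
def WeaklyIndiscernibleOver (B : Set M) (s : I → Fin n → M) : Prop :=
  QFIndiscernible (L.withConstants B) s

/-- The theory `T` has quantifier elimination: modulo `T`, every formula is equivalent to a
quantifier-free formula in the same free variables. -/
def HasQE {L : Language} (T : L.Theory) : Prop :=
  ∀ (k : ℕ) (φ : L.Formula (Fin k)), ∃ ψ : L.Formula (Fin k), ψ.IsQF ∧ T.Iff φ ψ

end ModelTheory

end DSet

/-! Picture `Ω` as ends of a tree, `D(wx;yz)` saying that the paths from `w` to `x` and from `y` to
`z` are disjoint. A petaled sequence spreads around a node, a monotonic one runs along a path, and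
the hull consists of the points whose position tells entries of the sequence apart.

For parameters outside the hull it suffices to move a single index from `p` to `q`, all other
indices lying outside the interval from `p` to `q` (`rel_iff_of_shift`). Such a parameter lies in no
petal of a petaled component, and on the same side of the entries at `p` and `q` of a monotonic one
(`Outside`). Entries with fixed index share this behaviour at `p` and `q`. This settles quadruples
with one moving entry (`sameType_one`). With two or three moving entries, a moving entry or a
parameter is exchanged for an entry with fixed index, until fewer entries move or only entries of
`s` remain (`sameType_two`, `sameType_three`). Quadruples of entries of `s` are covered by its
indiscernibility. Finally, two increasing tuples of indices are both linked by single moves to a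
third one beyond them (`weaklyIndiscernibleOver_of_outside`).

Conversely, each clause defining the hull describes a configuration of a point with a few entries
that cannot occur uniformly along the sequence (`notMem_singleHull`). Under quantifier elimination,
formulas with parameters reduce to quantifier-free ones (`HasQE.exists_isQF`). -/

namespace DSet

/-! ### Consequences of the axioms; exchanging points in quadruples -/

section Relation

variable {Ω : Type*} {D : Ω → Ω → Ω → Ω → Prop} {u v w x y z : Ω}

namespace IsDRelation

theorem swap_left (hD : IsDRelation D) (h : D w x y z) : D x w y z := (hD.d1 _ _ _ _ h).1

theorem flip (hD : IsDRelation D) (h : D w x y z) : D y z w x := (hD.d1 _ _ _ _ h).2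

theorem swap_right (hD : IsDRelation D) (h : D w x y z) : D w x z y :=
  hD.flip (hD.swap_left (hD.flip h))

theorem not_cross (hD : IsDRelation D) (h : D w x y z) : ¬ D w y x z := hD.d2 _ _ _ _ h

/-- If `w = y`, then (D4) yields `D(ww;xz)`, which (D2) forbids; the cases where `x` or `z` equals
`w` contradict (D2) directly. -/
theorem ne_of_rel (hD : IsDRelation D) (h : D w x y z) : w ≠ y := by
  rintro rfl
  by_cases hx : x = w
  · subst hx; exact hD.not_cross h h
  by_cases hz : z = w
  · subst hz; exact hD.not_cross (hD.swap_left h) (hD.swap_left h)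
  exact hD.not_cross h (hD.flip (hD.d4 _ _ _ hx hz))

/-- The symmetries of `D` and axiom (D2). -/
theorem symmetries (hD : IsDRelation D) : ∀ w x y z, D w x y z →
    D x w y z ∧ D y z w x ∧ D w x z y ∧ ¬ D w y x z :=
  fun _ _ _ _ h => ⟨hD.swap_left h, hD.flip h, hD.swap_right h, hD.not_cross h⟩

/-- `D(xy; ··)` is a transitive relation in its last two arguments. -/
theorem trans (hD : IsDRelation D) (h : D x y z w) (h' : D x y z v) : D x y w v := by
  have sym := hD.symmetries
  have a1 := hD.d3 _ _ _ _ (hD.swap_right h) v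
  have a2 := hD.d3 _ _ _ _ (hD.swap_left (hD.swap_right h)) v
  have a3 := hD.d3 _ _ _ _ (hD.swap_right h') w
  grind

/-- Replacing the second and the last argument. -/
theorem d3' (hD : IsDRelation D) (h : D w x y z) (v : Ω) : D w v y z ∨ D w x y v :=
  (hD.d3 _ _ _ _ (hD.swap_left h) v).imp hD.swap_left hD.swap_left

end IsDRelation

variable (D) in
/-- The `D`-relations between `w, x, y, z` are the same as those between `w', x', y', z'`. -/
def SameType (w x y z w' x' y' z' : Ω) : Prop :=
  (D w x y z ↔ D w' x' y' z') ∧ (D w y x z ↔ D w' y' x' z') ∧ (D w z x y ↔ D w' z' x' y')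

namespace SameType

variable {w' x' y' z' w'' x'' y'' z'' : Ω}

theorem rfl : SameType D w x y z w x y z := ⟨Iff.rfl, Iff.rfl, Iff.rfl⟩

theorem symm (h : SameType D w x y z w' x' y' z') : SameType D w' x' y' z' w x y z :=
  ⟨h.1.symm, h.2.1.symm, h.2.2.symm⟩

theorem trans (h : SameType D w x y z w' x' y' z')
    (h' : SameType D w' x' y' z' w'' x'' y'' z'') : SameType D w x y z w'' x'' y'' z'' :=
  ⟨h.1.trans h'.1, h.2.1.trans h'.2.1, h.2.2.trans h'.2.2⟩

theorem perm₁ (hD : IsDRelation D) (h : SameType D w x y z w' x' y' z') :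
    SameType D x w y z x' w' y' z' := by
  have sym := hD.symmetries
  obtain ⟨h1, h2, h3⟩ := h
  refine ⟨?_, ?_, ?_⟩ <;> grind

theorem perm₂ (hD : IsDRelation D) (h : SameType D w x y z w' x' y' z') :
    SameType D w y x z w' y' x' z' := by
  have sym := hD.symmetries
  obtain ⟨h1, h2, h3⟩ := h
  refine ⟨?_, ?_, ?_⟩ <;> grind

theorem perm₃ (hD : IsDRelation D) (h : SameType D w x y z w' x' y' z') :
    SameType D w x z y w' x' z' y' := by
  have sym := hD.symmetries
  obtain ⟨h1, h2, h3⟩ := h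
  refine ⟨?_, ?_, ?_⟩ <;> grind

end SameType

/-- If `D(xy;bc)`, then `x` and `y` are interchangeable in quadruples that contain `b` and `c`. -/
theorem sameType_of_rel (hD : IsDRelation D) {b c : Ω} (h : D x y b c) (d : Ω) :
    SameType D x b c d y b c d := by
  have sym := hD.symmetries
  have aux : ∀ x y, D x y b c → (D x b c d → D y b c d) ∧ (D x c b d → D y c b d) ∧
      (D x d b c → D y d b c) := by
    intro x y h
    refine ⟨fun g => ?_, fun g => ?_, fun g => ?_⟩
    · have := hD.d3 _ _ _ _ g y
      have := hD.d3 _ _ _ _ (hD.swap_right g) y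
      grind
    · have := hD.d3 _ _ _ _ g y
      have := hD.d3 _ _ _ _ (hD.swap_right g) y
      grind
    · have := hD.trans (hD.flip h) (hD.flip g)
      grind
  have h1 := aux x y h
  have h2 := aux y x (hD.swap_left h)
  exact ⟨⟨h1.1, h2.1⟩, ⟨h1.2.1, h2.2.1⟩, ⟨h1.2.2, h2.2.2⟩⟩

/-- Applying (D3) to a relation of `p` with `x, y, z` either replaces `p` by `q` or produces one of
the excluded relations. -/
theorem sameType_of_not_rel (hD : IsDRelation D) {p q : Ω}
    (hxz : ¬ D p x q z) (hzx : ¬ D p z q x) (hyz : ¬ D p y q z) (hzy : ¬ D p z q y) : SameType D p x y z q x y z := by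
  have sym := hD.symmetries
  have aux : ∀ x y z, ¬ D p x q z → ¬ D q x p z → (D p x y z ↔ D q x y z) := by
    intro x y z h1 h2
    constructor
    · intro g
      have := hD.d3 _ _ _ _ (hD.swap_right g) q
      grind
    · intro g
      have := hD.d3 _ _ _ _ (hD.swap_right g) p
      grind
  refine ⟨aux _ _ _ hxz ?_, aux _ _ _ hyz ?_, aux _ _ _ hzy ?_⟩ <;> grind

/-- On a path `l, p, q, r`, the points `x` beyond the left or the right end do not distinguish
`p` and `q`. -/
theorem sameType_of_sides (hD : IsDRelation D) {l p q r : Ω}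
    (hx : (D l p x r ∧ D l q x r) ∨ (D l x p r ∧ D l x q r))
    (hy : (D l p y r ∧ D l q y r) ∨ (D l y p r ∧ D l y q r))
    (hz : (D l p z r ∧ D l q z r) ∨ (D l z p r ∧ D l z q r)) :
    SameType D p x y z q x y z := by
  have aux : ∀ x y, ((D l p x r ∧ D l q x r) ∧ (D l p y r ∧ D l q y r)) ∨
      ((D l x p r ∧ D l x q r) ∧ (D l y p r ∧ D l y q r)) → D p q x y := by
    rintro x y (⟨⟨h1, h2⟩, h3, h4⟩ | ⟨⟨h1, h2⟩, h3, h4⟩)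
    · have h5 := hD.trans (hD.swap_right h1) (hD.swap_right h3)
      have h6 := hD.trans (hD.swap_right h2) (hD.swap_right h4)
      exact hD.flip (hD.trans (hD.flip h5) (hD.flip h6))
    · have h5 := hD.trans (hD.flip h1) (hD.flip h3)
      have h6 := hD.trans (hD.flip h2) (hD.flip h4)
      exact hD.flip (hD.trans (hD.swap_right (hD.flip h5)) (hD.swap_right (hD.flip h6)))
  have hxy : D p q x y → SameType D p x y z q x y z := fun h => sameType_of_rel hD h z
  have hxz : D p q x z → SameType D p x y z q x y z :=
    fun h => (sameType_of_rel hD h y).perm₃ hD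
  have hyz : D p q y z → SameType D p x y z q x y z :=
    fun h => ((sameType_of_rel hD h x).perm₃ hD).perm₂ hD
  -- Two of the three points lie on the same side. The path between these two avoids the one between
  -- `p` and `q`, so `sameType_of_rel` applies to them.
  rcases hx with hx | hx <;> rcases hy with hy | hy
  · exact hxy (aux _ _ (.inl ⟨hx, hy⟩))
  · rcases hz with hz | hz
    · exact hxz (aux _ _ (.inl ⟨hx, hz⟩))
    · exact hyz (aux _ _ (.inr ⟨hy, hz⟩))
  · rcases hz with hz | hz
    · exact hyz (aux _ _ (.inl ⟨hy, hz⟩))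
    · exact hxz (aux _ _ (.inr ⟨hx, hz⟩))
  · exact hxy (aux _ _ (.inr ⟨hx, hy⟩))

end Relation

/-! ### Petaled sequences and their sectors -/

section Sequences

variable {Ω I : Type*} {D : Ω → Ω → Ω → Ω → Prop} {a : I → Ω}

/-- The point `x` lies in the sector of `a i` of the node given by the petaled sequence `a`. -/
def Near (D : Ω → Ω → Ω → Ω → Prop) (a : I → Ω) (x : Ω) (i : I) : Prop :=
  ∃ j k, i ≠ j ∧ i ≠ k ∧ j ≠ k ∧ D x (a i) (a j) (a k)

/-- The witnesses in `Near` are arbitrary: if (D3) did not allow one of them to be exchanged, it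
would give a relation between four distinct entries. -/
theorem Near.rel (hD : IsDRelation D) (ha : IsPetaled D a) {x : Ω} {i j k : I} (h : Near D a x i)
    (hij : i ≠ j) (hik : i ≠ k) (hjk : j ≠ k) : D x (a i) (a j) (a k) := by
  have step : ∀ j k k', i ≠ j → i ≠ k → j ≠ k → i ≠ k' → j ≠ k' →
      D x (a i) (a j) (a k) → D x (a i) (a j) (a k') := by
    intro j k k' hij hik hjk hik' hjk' h
    by_cases hkk : k = k'
    · exact hkk ▸ h
    · refine (hD.d3 _ _ _ _ h (a k')).resolve_left fun g => ?_
      exact ha.2 k' i j k hik'.symm hjk'.symm (Ne.symm hkk) hij hik hjk g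
  obtain ⟨j', k', h1, h2, h3, h⟩ := h
  by_cases hj : j' = k
  · subst hj
    exact hD.swap_right (step _ _ _ h1 h2 h3 hij hjk.symm h)
  · have h5 := step _ _ _ h1 h2 h3 hik hj h
    exact hD.swap_right (step _ _ _ hik h1 (Ne.symm hj) hij hjk.symm (hD.swap_right h5))

theorem Near.unique [Infinite I] (hD : IsDRelation D) (ha : IsPetaled D a) {x : Ω} {i i' : I}
    (h : Near D a x i) (h' : Near D a x i') : i = i' := by
  classical
  by_contra hne
  obtain ⟨j, hj⟩ := Infinite.exists_notMem_finset {i, i'}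
  obtain ⟨k, hk⟩ := Infinite.exists_notMem_finset {i, i', j}
  simp only [Finset.mem_insert, Finset.mem_singleton, not_or] at hj hk
  have h1 := h.rel hD ha (Ne.symm hj.1) (Ne.symm hk.1) (Ne.symm hk.2.2)
  have h2 := h'.rel hD ha (Ne.symm hj.2) (Ne.symm hk.2.1) (Ne.symm hk.2.2)
  exact ha.2 j k i i' (Ne.symm hk.2.2) hj.1 hj.2 hk.1 hk.2.1 hne
    (hD.trans (hD.flip h1) (hD.flip h2))

theorem Near.self [Infinite I] (hD : IsDRelation D) (ha : IsPetaled D a) (i : I) :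
    Near D a (a i) i := by
  classical
  obtain ⟨j, hj⟩ := Infinite.exists_notMem_finset {i}
  obtain ⟨k, hk⟩ := Infinite.exists_notMem_finset {i, j}
  simp only [Finset.mem_insert, Finset.mem_singleton, not_or] at hj hk
  exact ⟨j, k, Ne.symm hj, Ne.symm hk.1, Ne.symm hk.2, hD.flip (hD.d4 _ _ _
    (fun h => hj (ha.1 h)) (fun h => hk.1 (ha.1 h)))⟩

theorem finite_setOf_near [Infinite I] (hD : IsDRelation D) (ha : IsPetaled D a) (x : Ω) :
    {i | Near D a x i}.Finite :=
  Set.Subsingleton.finite fun _ hi _ hj => Near.unique hD ha hi hj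

/-- Two points outside the sectors of `a p` and `a q` are not pairwise on the sides of these. -/
theorem not_rel_of_not_near (hD : IsDRelation D) {p q r : I} (hpq : p ≠ q)
    (hpr : p ≠ r) (hqr : q ≠ r) {x y : Ω} (hxp : ¬ Near D a x p) (hyq : ¬ Near D a y q) :
    ¬ D (a p) x (a q) y := by
  intro h
  have n1 : ¬ D (a p) x (a q) (a r) :=
    fun g => hxp ⟨q, r, hpq, hpr, hqr, hD.swap_left g⟩
  have n2 : ¬ D (a q) y (a p) (a r) :=
    fun g => hyq ⟨p, r, hpq.symm, hqr, hpr, hD.swap_left g⟩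
  have g1 := (hD.d3 _ _ _ _ h (a r)).resolve_right n1
  have g2 := (hD.d3 _ _ _ _ (hD.flip h) (a r)).resolve_right n2
  have g3 := (hD.d3 _ _ _ _ (hD.flip g1) (a p)).resolve_right
    fun g => n2 (hD.swap_right g)
  exact hD.not_cross (hD.swap_right g2) (hD.swap_right (hD.flip g3))

theorem sameType_of_not_near (hD : IsDRelation D) {p q r : I} (hpq : p ≠ q)
    (hpr : p ≠ r) (hqr : q ≠ r) {x y z : Ω} (hx : ¬ Near D a x p ∧ ¬ Near D a x q)
    (hy : ¬ Near D a y p ∧ ¬ Near D a y q) (hz : ¬ Near D a z p ∧ ¬ Near D a z q) :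
    SameType D (a p) x y z (a q) x y z := by
  have key : ∀ x y, (¬ Near D a x p ∧ ¬ Near D a x q) → (¬ Near D a y p ∧ ¬ Near D a y q) →
      ¬ D (a p) x (a q) y :=
    fun x y hx hy => not_rel_of_not_near hD hpq hpr hqr hx.1 hy.2
  exact sameType_of_not_rel hD (key _ _ hx hz) (key _ _ hz hx) (key _ _ hy hz) (key _ _ hz hy)

end Sequences

/-! ### Points in different sectors -/

section Sectors

variable {Ω : Type*} {D : Ω → Ω → Ω → Ω → Prop}

/-- If `x` and `y` are in different sectors of a node, then the relation of `x` and `y` to `a p`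
and a further point `c` is determined by relations in which only one of `a p`, `x`, `y` occurs with
`c`. -/
theorem sameType_of_different_sectors {I : Type*} (hD : IsDRelation D) {a : I → Ω} {p r u : I} (hpr : p ≠ r)
    (hpu : p ≠ u) (hru : r ≠ u) {x y c : Ω} (hxp : ¬ Near D a x p) (hxr : ¬ Near D a x r)
    (hyp : ¬ Near D a y p) (hyr : ¬ Near D a y r) (hyu : ¬ Near D a y u)
    (hxy : ¬ D (a p) (a u) x y) :
    (D (a p) c x y ↔ D (a p) c (a u) (a r)) ∧ (D (a p) x c y ↔ D (a r) x c y) ∧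
      (D (a p) y c x ↔ D (a r) y c x) := by
  have n1 : ¬ D (a p) x (a r) y := not_rel_of_not_near hD hpr hpu hru hxp hyr
  have n2 : ¬ D (a p) y (a r) x := not_rel_of_not_near hD hpr hpu hru hyp hxr
  have n3 : ¬ D (a p) (a r) (a u) y :=
    fun g => hyu ⟨p, r, hpu.symm, hru.symm, hpr, hD.swap_left (hD.flip g)⟩
  have n4 : ¬ D (a p) x (a u) (a r) :=
    fun g => hxp ⟨u, r, hpu, hpr, hru.symm, hD.swap_left g⟩
  refine ⟨⟨fun h => ?_, fun h => ?_⟩, ⟨fun h => ?_, fun h => ?_⟩, ⟨fun h => ?_, fun h => ?_⟩⟩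
  · have h1 := (hD.d3' (hD.swap_right h) (a u)).resolve_left fun g => hxy (hD.swap_right g)
    exact (hD.d3' (hD.swap_right h1) (a r)).resolve_left n3
  · have h1 := (hD.d3' (hD.swap_right h) x).resolve_left fun g => n4 (hD.swap_right g)
    exact (hD.d3' (hD.swap_right h1) y).resolve_left fun g => n2 (hD.swap_right g)
  · exact hD.swap_right ((hD.d3 _ _ _ _ (hD.swap_right h) (a r)).resolve_right
      fun g => n1 (hD.swap_right g))
  · exact hD.swap_right ((hD.d3 _ _ _ _ (hD.swap_right h) (a p)).resolve_right
      fun g => n2 (hD.swap_left (hD.flip g)))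
  · exact hD.swap_right ((hD.d3 _ _ _ _ (hD.swap_right h) (a r)).resolve_right
      fun g => n2 (hD.swap_right g))
  · exact hD.swap_right ((hD.d3 _ _ _ _ (hD.swap_right h) (a p)).resolve_right
      fun g => n1 (hD.swap_left (hD.flip g)))

end Sectors

/-! ### The trichotomy for indiscernible sequences -/

section Components

variable {Ω I : Type*} {D : Ω → Ω → Ω → Ω → Prop} [LinearOrder I] {a : I → Ω}

/-- The symmetries of `D` move the least index to the front and order the last two, which leaves the
three pairings of an increasing quadruple. -/
theorem isPetaled_of_increasing (hD : IsDRelation D) (hinj : Function.Injective a)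
    (h₁ : ∀ i j k l, i < j → j < k → k < l → ¬ D (a i) (a j) (a k) (a l))
    (h₂ : ∀ i j k l, i < j → j < k → k < l → ¬ D (a i) (a k) (a j) (a l))
    (h₃ : ∀ i j k l, i < j → j < k → k < l → ¬ D (a i) (a l) (a j) (a k)) : IsPetaled D a := by
  have aux : ∀ i j k l, i < j → i < k → k < l → j ≠ k → j ≠ l → ¬ D (a i) (a j) (a k) (a l) := by
    intro i j k l hij hik hkl hjk hjl
    rcases lt_or_gt_of_ne hjk with h | h
    · exact h₁ _ _ _ _ hij h hkl
    rcases lt_or_gt_of_ne hjl with h' | h'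
    · exact h₂ _ _ _ _ hik h h'
    · exact h₃ _ _ _ _ hik hkl h'
  have aux' : ∀ i j k l, i < j → i < k → i < l → j ≠ k → j ≠ l → k ≠ l →
      ¬ D (a i) (a j) (a k) (a l) := by
    intro i j k l hij hik hil hjk hjl hkl h
    rcases lt_or_gt_of_ne hkl with h' | h'
    · exact aux _ _ _ _ hij hik h' hjk hjl h
    · exact aux _ _ _ _ hij hil h' hjl hjk (hD.swap_right h)
  refine ⟨hinj, fun i j k l hij hik hil hjk hjl hkl h => ?_⟩
  rcases lt_or_gt_of_ne hij with h1 | h1 <;> rcases lt_or_gt_of_ne hkl with h2 | h2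
  · rcases lt_or_gt_of_ne hik with h3 | h3
    · exact aux' i j k l h1 h3 (h3.trans h2) hjk hjl hkl h
    · exact aux' k l i j h2 h3 (h3.trans h1) hil.symm hjl.symm hij (hD.flip h)
  · rcases lt_or_gt_of_ne hil with h3 | h3
    · exact aux' i j k l h1 (h3.trans h2) h3 hjk hjl hkl h
    · exact aux' l k i j h2 h3 (h3.trans h1) hik.symm hjk.symm hij
        (hD.flip (hD.swap_right h))
  · rcases lt_or_gt_of_ne hjk with h3 | h3
    · exact aux' j i k l h1 h3 (h3.trans h2) hik hil hkl (hD.swap_left h)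
    · exact aux' k l j i h2 h3 (h3.trans h1) hjl.symm hil.symm hij.symm
        (hD.flip (hD.swap_left h))
  · rcases lt_or_gt_of_ne hjl with h3 | h3
    · exact aux' j i k l h1 (h3.trans h2) h3 hik hil hkl (hD.swap_left h)
    · exact aux' l k j i h2 h3 (h3.trans h1) hjk.symm hik.symm hij.symm
        (hD.flip (hD.swap_left (hD.swap_right h)))

/-- An indiscernible sequence is constant, petaled or monotonic. -/
theorem isConstant_or_isPetaled_or_isMonotonic [NoMaxOrder I] (hD : IsDRelation D)
    (heq : ∀ i j i' j', i < j → i' < j' → a i = a j → a i' = a j')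
    (hrel : ∀ f g : Fin 4 → I, (∀ x y, f x < f y ↔ g x < g y) →
      (D (a (f 0)) (a (f 1)) (a (f 2)) (a (f 3)) ↔ D (a (g 0)) (a (g 1)) (a (g 2)) (a (g 3)))) :
    IsConstant a ∨ IsPetaled D a ∨ IsMonotonic D a := by
  by_cases hc : IsConstant a
  · exact .inl hc
  have hne : ∀ i j, i < j → a i ≠ a j := by
    intro i j hij h
    refine hc fun i' j' => ?_
    rcases lt_trichotomy i' j' with h' | rfl | h'
    · exact heq _ _ _ _ hij h' h
    · rfl
    · exact (heq _ _ _ _ hij h' h).symm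
  have hinj : Function.Injective a := by
    intro i j h
    by_contra hij
    rcases lt_or_gt_of_ne hij with h' | h'
    · exact hne _ _ h' h
    · exact hne _ _ h' h.symm
  have hrel' : ∀ (σ : Fin 4 → Fin 4) (f g : Fin 4 → I), StrictMono f → StrictMono g →
      D (a (f (σ 0))) (a (f (σ 1))) (a (f (σ 2))) (a (f (σ 3))) →
      D (a (g (σ 0))) (a (g (σ 1))) (a (g (σ 2))) (a (g (σ 3))) := fun σ f g hf hg h =>
    (hrel (f ∘ σ) (g ∘ σ) fun x y => by
      simp [Function.comp_apply, hf.lt_iff_lt, hg.lt_iff_lt]).1 h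
  have hmono : ∀ i j k l : I, i < j → j < k → k < l → StrictMono ![i, j, k, l] := by
    intro i j k l h1 h2 h3
    refine Fin.strictMono_iff_lt_succ.2 fun x => ?_
    fin_cases x <;> simpa
  have main : ∀ σ : Fin 4 → Fin 4, (∀ f : Fin 4 → I, StrictMono f →
      ¬ D (a (f (σ 0))) (a (f (σ 1))) (a (f (σ 2))) (a (f (σ 3)))) ∨
      (∀ f : Fin 4 → I, StrictMono f →
        D (a (f (σ 0))) (a (f (σ 1))) (a (f (σ 2))) (a (f (σ 3)))) := by
    intro σ
    by_contra! h
    obtain ⟨⟨f, hf, h1⟩, g, hg, h2⟩ := h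
    exact h2 (hrel' σ f g hf hg h1)
  obtain ⟨i₁⟩ : Nonempty I := by
    by_contra h
    exact hc fun i => (h ⟨i⟩).elim
  obtain ⟨i₂, h12⟩ := exists_gt i₁
  obtain ⟨i₃, h23⟩ := exists_gt i₂
  obtain ⟨i₄, h34⟩ := exists_gt i₃
  obtain ⟨i₅, h45⟩ := exists_gt i₄
  have m1 := hmono i₁ i₂ i₃ i₄ h12 h23 h34
  have m2 := hmono i₁ i₂ i₃ i₅ h12 h23 (h34.trans h45)
  have m3 := hmono i₁ i₂ i₄ i₅ h12 (h23.trans h34) h45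
  have m4 := hmono i₁ i₃ i₄ i₅ (h12.trans h23) h34 h45
  have m5 := hmono i₂ i₃ i₄ i₅ h23 h34 h45
  have sym := hD.symmetries
  -- Each pairing holds on all increasing quadruples or on none. The pairings 02|13 and 03|12 cannot
  -- hold on all, as five increasing indices already show; 01|23 distinguishes monotonic from
  -- petaled.
  rcases main ![0, 2, 1, 3] with hB | hB
  swap
  · exfalso
    have g1 := hB _ m1
    have g2 := hB _ m2
    have g3 := hB _ m3
    have g4 := hB _ m4
    have g5 := hB _ m5
    simp only [Matrix.cons_val] at g1 g2 g3 g4 g5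
    have := hD.d3 _ _ _ _ (hD.swap_right g2) (a i₄)
    have := hD.d3 _ _ _ _ (hD.swap_left (hD.swap_right g2)) (a i₄)
    have := hD.d3 _ _ _ _ (hD.swap_right g1) (a i₅)
    clear hB m1 m2 m3 m4 m5 main hmono hrel' hrel heq hne
    grind
  rcases main ![0, 3, 1, 2] with hC | hC
  swap
  · exfalso
    have g1 := hC _ m1
    have g3 := hC _ m3
    have g5 := hC _ m5
    simp only [Matrix.cons_val] at g1 g3 g5
    have := hD.d3 _ _ _ _ g1 (a i₅)
    clear hC m1 m2 m3 m4 m5 main hmono hrel' hrel heq hne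
    grind
  rcases main id with hA | hA
  · exact .inr (.inl (isPetaled_of_increasing hD hinj
      (fun i j k l h1 h2 h3 => hA _ (hmono i j k l h1 h2 h3))
      (fun i j k l h1 h2 h3 => hB _ (hmono i j k l h1 h2 h3))
      (fun i j k l h1 h2 h3 => hC _ (hmono i j k l h1 h2 h3))))
  · exact .inr (.inr ⟨hinj, fun i j k l h1 h2 h3 => hA _ (hmono i j k l h1 h2 h3)⟩)

end Components

/-! ### Moving a single index from `p` to `q` -/

section Shift

variable {Ω I κ : Type*} [LinearOrder I] {D : Ω → Ω → Ω → Ω → Prop} {s : I → κ → Ω}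

variable (D) in
/-- Whether `D` holds for four entries of `s` depends only on their components and on the order
of their indices. -/
def RelIndiscernible (s : I → κ → Ω) : Prop :=
  ∀ (f g : Fin 4 → I), (∀ x y, f x < f y ↔ g x < g y) → ∀ k : Fin 4 → κ,
    (D (s (f 0) (k 0)) (s (f 1) (k 1)) (s (f 2) (k 2)) (s (f 3) (k 3)) ↔
      D (s (g 0) (k 0)) (s (g 1) (k 1)) (s (g 2) (k 2)) (s (g 3) (k 3)))

/-- `v` and `w` are the same entry of `s` before and after the index `p` is replaced by `q`. -/
def Moves (s : I → κ → Ω) (p q : I) (v w : Ω) : Prop :=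
  ∃ i j k, ((i = p ∧ j = q) ∨ (i = j ∧ (i < p ∨ q < i))) ∧ v = s i k ∧ w = s j k

theorem Moves.moving (s : I → κ → Ω) (p q : I) (k : κ) : Moves s p q (s p k) (s q k) :=
  ⟨p, q, k, .inl ⟨rfl, rfl⟩, rfl, rfl⟩

theorem Moves.fixed (s : I → κ → Ω) {p q i : I} (h : i < p ∨ q < i) (k : κ) :
    Moves s p q (s i k) (s i k) :=
  ⟨i, i, k, .inr ⟨rfl, h⟩, rfl, rfl⟩

/-- No fixed index lies between `p` and `q`, so the move preserves the order of the indices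
involved. -/
theorem RelIndiscernible.sameType (hs : RelIndiscernible D s) {p q : I} (hpq : p < q)
    {w x y z w' x' y' z' : Ω} (hw : Moves s p q w w') (hx : Moves s p q x x')
    (hy : Moves s p q y y') (hz : Moves s p q z z') : SameType D w x y z w' x' y' z' := by
  have aux : ∀ w x y z w' x' y' z', Moves s p q w w' → Moves s p q x x' →
      Moves s p q y y' → Moves s p q z z' → (D w x y z ↔ D w' x' y' z') := by
    rintro _ _ _ _ _ _ _ _ ⟨i₀, j₀, k₀, h₀, rfl, rfl⟩ ⟨i₁, j₁, k₁, h₁, rfl, rfl⟩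
      ⟨i₂, j₂, k₂, h₂, rfl, rfl⟩ ⟨i₃, j₃, k₃, h₃, rfl, rfl⟩
    have key : ∀ i j i' j' : I, ((i = p ∧ j = q) ∨ (i = j ∧ (i < p ∨ q < i))) →
        ((i' = p ∧ j' = q) ∨ (i' = j' ∧ (i' < p ∨ q < i'))) → (i < i' ↔ j < j') := by
      intro i j i' j' h h'
      grind
    have hall : ∀ x, ((![i₀, i₁, i₂, i₃] x = p ∧ ![j₀, j₁, j₂, j₃] x = q) ∨
        (![i₀, i₁, i₂, i₃] x = ![j₀, j₁, j₂, j₃] x ∧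
          (![i₀, i₁, i₂, i₃] x < p ∨ q < ![i₀, i₁, i₂, i₃] x))) := by
      intro x
      fin_cases x <;> assumption
    exact hs ![i₀, i₁, i₂, i₃] ![j₀, j₁, j₂, j₃] (fun x y => key _ _ _ _ (hall x) (hall y))
      ![k₀, k₁, k₂, k₃]
  exact ⟨aux _ _ _ _ _ _ _ _ hw hx hy hz, aux _ _ _ _ _ _ _ _ hw hy hx hz,
    aux _ _ _ _ _ _ _ _ hw hz hx hy⟩

variable (D) in
/-- The position of `x` relative to the components of `s`, if `x` is not in the hull of `s`. -/
structure Outside (s : I → κ → Ω) (x : Ω) : Prop where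
  petaled : ∀ k, IsPetaled D (fun i => s i k) → ∀ i, ¬ Near D (fun i => s i k) x i
  monotonic : ∀ k, IsMonotonic D (fun i => s i k) → ∀ l p q r, l < p → p < q → q < r →
    (D (s l k) (s p k) x (s r k) ∧ D (s l k) (s q k) x (s r k)) ∨
    (D (s l k) x (s p k) (s r k) ∧ D (s l k) x (s q k) (s r k))

variable (D) in
/-- The parameters that are allowed when the index `p` is replaced by `q`. -/
def Fixed (s : I → κ → Ω) (p q : I) (x : Ω) : Prop :=
  Outside D s x ∨ ∃ i k, (i < p ∨ q < i) ∧ x = s i k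

theorem Fixed.entry {p q i : I} (h : i < p ∨ q < i) (k : κ) : Fixed D s p q (s i k) :=
  .inr ⟨i, k, h, rfl⟩

theorem Fixed.sides (hD : IsDRelation D) (hs : RelIndiscernible D s) {p q l r : I} (hpq : p < q)
    {x : Ω} (hx : Fixed D s p q x) {k : κ} (hk : IsMonotonic D (fun i => s i k)) (hl : l < p)
    (hr : q < r) :
    (D (s l k) (s p k) x (s r k) ∧ D (s l k) (s q k) x (s r k)) ∨
    (D (s l k) x (s p k) (s r k) ∧ D (s l k) x (s q k) (s r k)) := by
  obtain hx | ⟨i, k', hi, rfl⟩ := hx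
  · exact hx.monotonic k hk l p q r hl hpq hr
  · have h := hs.sameType hpq (.fixed s (.inl hl) k) (.moving s p q k) (.fixed s hi k')
      (.fixed s (.inr hr) k)
    -- (D3) finds the side of the entry relative to one of the two moving positions; the shift `h`
    -- carries it to the other.
    rcases hD.d3' (hD.swap_right (hk.2 _ _ _ _ hl hpq hr)) (s i k') with h3 | h3
    · exact .inr ⟨h.2.1.2 (hD.swap_right h3), hD.swap_right h3⟩
    · exact .inl ⟨hD.swap_right h3, h.1.1 (hD.swap_right h3)⟩

/-- Here `x` is on the side of `s l k` and `y` on that of `s r k`, so these entries can stand in for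
`x` and `y`, and only entries of `s` remain. -/
theorem sameType_two_of_between (hD : IsDRelation D) (hs : RelIndiscernible D s)
    {p q : I} (hpq : p < q) {k k' : κ} {x y : Ω} {l r : I} (hl : l < p) (hr : q < r)
    (hx : D (s l k) x (s p k) (s r k) ∧ D (s l k) x (s q k) (s r k))
    (hy : D (s l k) (s p k) y (s r k) ∧ D (s l k) (s q k) y (s r k)) :
    SameType D (s p k) (s p k') x y (s q k) (s q k') x y := by
  have aux : ∀ p c, D (s l k) x (s p k) (s r k) → D (s l k) (s p k) y (s r k) →
      SameType D (s p k) c x y (s p k) c (s l k) (s r k) := by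
    intro p c h1 h2
    have h3 := (hD.d3' h1 y).resolve_left fun g => hD.not_cross g h2
    have h4 := sameType_of_rel hD (hD.swap_left h3) c
    have h5 := sameType_of_rel hD (hD.flip h2) c
    exact (((h4.perm₁ hD).perm₃ hD).perm₂ hD).trans
      (((((h5.perm₁ hD).perm₂ hD).perm₁ hD).perm₃ hD).perm₂ hD)
  exact ((aux p _ hx.1 hy.1).trans (hs.sameType hpq (.moving s p q k) (.moving s p q k')
    (.fixed s (.inl hl) k) (.fixed s (.inr hr) k))).trans (aux q _ hx.2 hy.2).symm

/-- There are arbitrarily large indices whose sectors do not contain `x` or `y`. -/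
theorem exists_gt_not_near [NoMaxOrder I] (hD : IsDRelation D) {a : I → Ω} (ha : IsPetaled D a) (x y : Ω)
    (q : I) : ∃ r, q < r ∧ ¬ Near D a x r ∧ ¬ Near D a y r := by
  have : Nonempty I := ⟨q⟩
  have : Infinite I := NoMaxOrder.infinite
  obtain ⟨r, hr, hr'⟩ := (Set.Ioi_infinite q).exists_notMem_finite
    ((finite_setOf_near hD ha x).union (finite_setOf_near hD ha y))
  exact ⟨r, hr, fun h => hr' (.inl h), fun h => hr' (.inr h)⟩

variable [NoMinOrder I] [NoMaxOrder I]

/-- If `i ≠ j`, indiscernibility allows `i` to be moved away from `j`, so that the entry at `j`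
would lie in two sectors. -/
theorem eq_of_near_entry (hD : IsDRelation D) (hs : RelIndiscernible D s) {k k' : κ}
    (hk : IsPetaled D (fun i => s i k)) {i j : I} (h : Near D (fun i => s i k) (s j k') i) :
    i = j := by
  have : Nonempty I := ⟨i⟩
  have : Infinite I := NoMaxOrder.infinite
  by_contra hij
  rcases lt_or_gt_of_ne hij with hij | hij
  · obtain ⟨u, hu⟩ := exists_gt j
    obtain ⟨v, hv⟩ := exists_gt u
    obtain ⟨i', hi'⟩ := exists_lt i
    have h1 := h.rel hD hk (hij.trans hu).ne (hij.trans (hu.trans hv)).ne hv.ne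
    have h2 := hs.sameType hi' (.fixed s (.inr hij) k') (.moving s i' i k)
      (.fixed s (.inr (hij.trans hu)) k) (.fixed s (.inr (hij.trans (hu.trans hv))) k)
    exact hi'.ne (Near.unique hD hk ⟨u, v, (hi'.trans (hij.trans hu)).ne,
      (hi'.trans (hij.trans (hu.trans hv))).ne, hv.ne, h2.1.2 h1⟩ h)
  · obtain ⟨u, hu⟩ := exists_lt j
    obtain ⟨v, hv⟩ := exists_lt u
    obtain ⟨i', hi'⟩ := exists_gt i
    have h1 := h.rel hD hk (hu.trans hij).ne' (hv.trans (hu.trans hij)).ne' hv.ne'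
    have h2 := hs.sameType hi' (.fixed s (.inl hij) k') (.moving s i i' k)
      (.fixed s (.inl (hu.trans hij)) k) (.fixed s (.inl (hv.trans (hu.trans hij))) k)
    exact hi'.ne (Near.unique hD hk h ⟨u, v, ((hu.trans hij).trans hi').ne',
      ((hv.trans (hu.trans hij)).trans hi').ne', hv.ne', h2.1.1 h1⟩)

theorem Fixed.not_near (hD : IsDRelation D) (hs : RelIndiscernible D s) {p q : I} (hpq : p < q)
    {x : Ω} (hx : Fixed D s p q x) {k : κ} (hk : IsPetaled D (fun i => s i k)) :
    ¬ Near D (fun i => s i k) x p ∧ ¬ Near D (fun i => s i k) x q := by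
  obtain hx | ⟨i, k', hi, rfl⟩ := hx
  · exact ⟨hx.petaled k hk p, hx.petaled k hk q⟩
  · constructor <;>
    · intro h
      have := eq_of_near_entry hD hs hk h
      subst this
      rcases hi with hi | hi
      · exact absurd hi (by first | exact lt_irrefl _ | exact hpq.le.not_gt)
      · exact absurd hi (by first | exact lt_irrefl _ | exact hpq.le.not_gt)

variable (hD : IsDRelation D) (hs : RelIndiscernible D s)
  (hT : ∀ k, IsConstant (fun i => s i k) ∨ IsPetaled D (fun i => s i k) ∨
    IsMonotonic D (fun i => s i k))
  {p q : I} (hpq : p < q)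
include hD hs hT hpq

theorem sameType_one (k : κ) {x y z : Ω} (hx : Fixed D s p q x) (hy : Fixed D s p q y)
    (hz : Fixed D s p q z) : SameType D (s p k) x y z (s q k) x y z := by
  obtain ⟨l, hl⟩ := exists_lt p
  obtain ⟨r, hr⟩ := exists_gt q
  rcases hT k with hk | hk | hk
  · rw [show s p k = s q k from hk p q]
    exact .rfl
  · exact sameType_of_not_near hD hpq.ne (hpq.trans hr).ne hr.ne (hx.not_near hD hs hpq hk)
      (hy.not_near hD hs hpq hk) (hz.not_near hD hs hpq hk)
  · exact sameType_of_sides hD (hx.sides hD hs hpq hk hl hr) (hy.sides hD hs hpq hk hl hr)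
      (hz.sides hD hs hpq hk hl hr)

/-- If an entry `t` with fixed index is on the same side of `x` and `y` as the entries `s p k` and
`s q k`, then it can take their place. -/
theorem sameType_two_of_rel {k k' : κ} {x y t : Ω} (hx : Fixed D s p q x) (hy : Fixed D s p q y)
    (ht : Fixed D s p q t) (hp : D (s p k) t x y) (hq : D (s q k) t x y) :
    SameType D (s p k) (s p k') x y (s q k) (s q k') x y := by
  have h1 := ((sameType_of_rel hD hp (s p k')).perm₃ hD).perm₂ hD
  have h2 := ((sameType_of_rel hD hq (s q k')).perm₃ hD).perm₂ hD
  exact h1.trans (((sameType_one hD hs hT hpq k' ht hx hy).perm₁ hD).trans h2.symm)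

/-- If `x` and `y` lie in the same sector, or on the same side, an entry with fixed index replaces
`s p k` and `s q k`, and one moving entry is left. Different sectors and opposite sides are the
remaining cases. -/
theorem sameType_two (k k' : κ) {x y : Ω} (hx : Fixed D s p q x) (hy : Fixed D s p q y) :
    SameType D (s p k) (s p k') x y (s q k) (s q k') x y := by
  rcases hT k with hk | hk | hk
  · obtain ⟨l, hl⟩ := exists_lt p
    have hkp : s p k = s l k := hk p l
    have hkq : s q k = s l k := hk q l
    rw [hkp, hkq]
    exact (sameType_one hD hs hT hpq k' (Fixed.entry (.inl hl) k) hx hy).perm₁ hD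
  · obtain ⟨r, hr, hxr, hyr⟩ := exists_gt_not_near hD hk x y q
    obtain ⟨u, hu, hxu, hyu⟩ := exists_gt_not_near hD hk x y r
    have hx' := hx.not_near hD hs hpq hk
    have hy' := hy.not_near hD hs hpq hk
    have hur : q < u := hr.trans hu
    -- Since `x` and `y` avoid the sectors of `s p k` and `s u k`, this asks whether they share a
    -- sector.
    by_cases h : D (s p k) (s u k) x y
    · refine sameType_two_of_rel hD hs hT hpq hx hy (Fixed.entry (.inr hur) k) h ?_
      exact (hD.d3 _ _ _ _ h (s q k)).resolve_right fun g => hx'.2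
        ⟨p, u, hpq.ne', hur.ne, (hpq.trans hur).ne, hD.flip g⟩
    have h' : ¬ D (s q k) (s u k) x y := fun h' => h <|
      (hD.d3 _ _ _ _ h' (s p k)).resolve_right fun g => hx'.1
        ⟨q, u, hpq.ne, (hpq.trans hur).ne, hur.ne, hD.flip g⟩
    have e1 := sameType_of_different_sectors hD (a := fun i => s i k) (c := s p k')
      (hpq.trans hr).ne (hpq.trans hur).ne hu.ne hx'.1 hxr hy'.1 hyr hyu h
    have e2 := sameType_of_different_sectors hD (a := fun i => s i k) (c := s q k')
      hr.ne hur.ne hu.ne hx'.2 hxr hy'.2 hyr hyu h'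
    have e3 := hs.sameType hpq (.moving s p q k) (.moving s p q k') (.fixed s (.inr hur) k)
      (.fixed s (.inr hr) k)
    have e4 := (sameType_one hD hs hT hpq k' (Fixed.entry (.inr hr) k) hx hy).perm₁ hD
    exact ⟨(e1.1.trans e3.1).trans e2.1.symm, (e1.2.1.trans e4.2.1).trans e2.2.1.symm,
      (e1.2.2.trans e4.2.2).trans e2.2.2.symm⟩
  · obtain ⟨l, hl⟩ := exists_lt p
    obtain ⟨r, hr⟩ := exists_gt q
    rcases hx.sides hD hs hpq hk hl hr with hx' | hx' <;>
    rcases hy.sides hD hs hpq hk hl hr with hy' | hy'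
    · refine sameType_two_of_rel hD hs hT hpq hx hy (Fixed.entry (.inl hl) k) ?_ ?_
      · exact hD.swap_left (hD.trans (hD.swap_right hx'.1) (hD.swap_right hy'.1))
      · exact hD.swap_left (hD.trans (hD.swap_right hx'.2) (hD.swap_right hy'.2))
    · have := sameType_two_of_between hD hs hpq (k' := k') hl hr hy' hx'
      exact this.perm₃ hD
    · exact sameType_two_of_between hD hs hpq (k' := k') hl hr hx' hy'
    · refine sameType_two_of_rel hD hs hT hpq hx hy (Fixed.entry (.inr hr) k) ?_ ?_
      · exact hD.trans (hD.flip hx'.1) (hD.flip hy'.1)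
      · exact hD.trans (hD.flip hx'.2) (hD.flip hy'.2)

/-- If `D(s p k, s p k'; x, s r k)`, then `s r k` can replace `x`, leaving entries of `s` only.
Otherwise `s l k` can replace `s p k`, leaving two moving entries. Which case occurs is not affected
by the shift, since it depends on one moving entry (`h3`). The order of `l` and `r` is left open so
that either side of `x` is covered. -/
theorem sameType_three_of_side {k : κ} (k' k'' : κ) {l r : I} {x : Ω} (hx : Fixed D s p q x)
    (hl : l < p ∨ q < l) (hr : r < p ∨ q < r) (hp : D (s l k) (s p k) x (s r k))
    (hq : D (s l k) (s q k) x (s r k)) :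
    SameType D (s p k) (s p k') (s p k'') x (s q k) (s q k') (s q k'') x := by
  have h1 : D (s p k) (s p k') x (s r k) ↔ D (s l k) (s p k') x (s r k) :=
    (sameType_of_rel hD (hD.swap_left hp) (s p k')).2.2
  have h2 : D (s q k) (s q k') x (s r k) ↔ D (s l k) (s q k') x (s r k) :=
    (sameType_of_rel hD (hD.swap_left hq) (s q k')).2.2
  have h3 : D (s l k) (s p k') x (s r k) ↔ D (s l k) (s q k') x (s r k) :=
    ((sameType_one hD hs hT hpq k' (Fixed.entry hl k) hx (Fixed.entry hr k)).perm₁ hD).1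
  by_cases h : D (s p k) (s p k') x (s r k)
  · have h' := h2.2 (h3.1 (h1.1 h))
    have aux : ∀ u v w, D u v x (s r k) → SameType D u v w x u v w (s r k) := fun u v w g =>
      ((((sameType_of_rel hD (hD.flip g) w).perm₁ hD).perm₂ hD).perm₃ hD)
    exact ((aux _ _ _ h).trans (hs.sameType hpq (.moving s p q k) (.moving s p q k')
      (.moving s p q k'') (.fixed s hr k))).trans (aux _ _ _ h').symm
  · have h' : ¬ D (s q k) (s q k') x (s r k) := fun g => h (h1.2 (h3.2 (h2.1 g)))
    have aux : ∀ u v w, ¬ D u v x (s r k) → D (s l k) u x (s r k) →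
        SameType D u v w x (s l k) v w x := fun u v w g g' => by
      have g1 : D u (s l k) x v := (hD.d3' (hD.swap_left g') v).resolve_left g
      exact ((sameType_of_rel hD g1 w).perm₂ hD).perm₃ hD
    have h4 := sameType_two hD hs hT hpq k' k'' (Fixed.entry hl k) hx
    exact ((aux _ _ _ h hp).trans ((h4.perm₂ hD).perm₁ hD)).trans (aux _ _ _ h' hq).symm

theorem sameType_three (k k' k'' : κ) {x : Ω} (hx : Fixed D s p q x) :
    SameType D (s p k) (s p k') (s p k'') x (s q k) (s q k') (s q k'') x := by
  rcases hT k with hk | hk | hk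
  · obtain ⟨l, hl⟩ := exists_lt p
    have hkp : s p k = s l k := hk p l
    have hkq : s q k = s l k := hk q l
    rw [hkp, hkq]
    exact ((sameType_two hD hs hT hpq k' k'' (Fixed.entry (.inl hl) k) hx).perm₂ hD).perm₁ hD
  · obtain ⟨r, hr, hxr, -⟩ := exists_gt_not_near hD hk x x q
    obtain ⟨u, hu, hxu, -⟩ := exists_gt_not_near hD hk x x r
    have hx' := hx.not_near hD hs hpq hk
    have hur : q < u := hr.trans hu
    have hrel : ∀ k', D (s u k) (s r k) (s p k) (s p k') ↔ D (s u k) (s r k) (s q k) (s q k') :=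
      fun k' => (hs.sameType hpq (.fixed s (.inr hur) k) (.fixed s (.inr hr) k)
        (.moving s p q k) (.moving s p q k')).1
    have swap : ∀ i, i ≤ q → ¬ Near D (fun i => s i k) x i → ∀ v w, D (s u k) (s r k) (s i k) v →
        SameType D (s i k) v w x (s i k) v w (s r k) := by
      intro i hi hxi v w h
      have h1 := (hD.d3 _ _ _ _ h x).resolve_right fun g => hxi
        ⟨u, r, (hi.trans_lt hur).ne, (hi.trans_lt hr).ne, hu.ne', hD.swap_left (hD.flip g)⟩
      exact ((sameType_of_rel hD h1 w).perm₁ hD).perm₂ hD |>.perm₃ hD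
    have swap' : ∀ k' k'', D (s u k) (s r k) (s p k) (s p k') →
        SameType D (s p k) (s p k') (s p k'') x (s q k) (s q k') (s q k'') x :=
      fun k' k'' h => ((swap p hpq.le hx'.1 _ _ h).trans (hs.sameType hpq (.moving s p q k)
        (.moving s p q k') (.moving s p q k'') (.fixed s (.inr hr) k))).trans
        (swap q le_rfl hx'.2 _ _ ((hrel k').1 h)).symm
    -- If another moving entry lies in the sector of `s p k`, then `s r k` can replace `x`. If
    -- neither does, both of them and `x` avoid the sectors of `s p k` and `s r k`, so `s r k` can
    -- replace `s p k`.
    by_cases h' : D (s u k) (s r k) (s p k) (s p k')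
    · exact swap' k' k'' h'
    by_cases h'' : D (s u k) (s r k) (s p k) (s p k'')
    · exact (swap' k'' k' h'').perm₂ hD
    have hI : Nonempty I := ⟨p⟩
    have hI' : Infinite I := NoMaxOrder.infinite
    have near : ∀ i, i ≤ q → ∀ k', ¬ D (s u k) (s r k) (s i k) (s i k') →
        ¬ Near D (fun i => s i k) (s i k') i ∧ ¬ Near D (fun i => s i k) (s i k') r := by
      intro i hi k' h
      refine ⟨fun g => h (hD.flip (hD.swap_left ?_)), fun g => ?_⟩
      · exact g.rel hD hk (hi.trans_lt hur).ne (hi.trans_lt hr).ne hu.ne'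
      · exact (hi.trans_lt hr).ne' (eq_of_near_entry hD hs hk g)
    have h1 := sameType_of_not_near hD (hpq.trans hr).ne (hpq.trans hur).ne hu.ne
      (near p hpq.le k' h') (near p hpq.le k'' h'') ⟨hx'.1, hxr⟩
    have h2 := sameType_of_not_near hD hr.ne hur.ne hu.ne
      (near q le_rfl k' fun g => h' ((hrel k').2 g))
      (near q le_rfl k'' fun g => h'' ((hrel k'').2 g)) ⟨hx'.2, hxr⟩
    have h3 := sameType_two hD hs hT hpq k' k'' (Fixed.entry (.inr hr) k) hx
    exact (h1.trans ((h3.perm₂ hD).perm₁ hD)).trans h2.symm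
  · obtain ⟨l, hl⟩ := exists_lt p
    obtain ⟨r, hr⟩ := exists_gt q
    rcases hx.sides hD hs hpq hk hl hr with hx' | hx'
    · exact sameType_three_of_side hD hs hT hpq k' k'' hx (.inl hl) (.inr hr) hx'.1 hx'.2
    · exact sameType_three_of_side hD hs hT hpq k' k'' hx (.inr hr) (.inl hl)
        (hD.swap_left (hD.swap_right (hD.flip hx'.1)))
        (hD.swap_left (hD.swap_right (hD.flip hx'.2)))

/-- Replacing one index does not change the `D`-relations between entries of `s` and points outside
the hull of `s`. -/
theorem rel_iff_of_shift {w x y z w' x' y' z' : Ω}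
    (hw : (∃ k, w = s p k ∧ w' = s q k) ∨ (w = w' ∧ Fixed D s p q w))
    (hx : (∃ k, x = s p k ∧ x' = s q k) ∨ (x = x' ∧ Fixed D s p q x))
    (hy : (∃ k, y = s p k ∧ y' = s q k) ∨ (y = y' ∧ Fixed D s p q y))
    (hz : (∃ k, z = s p k ∧ z' = s q k) ∨ (z = z' ∧ Fixed D s p q z)) :
    D w x y z ↔ D w' x' y' z' := by
  have h1 := fun (k : κ) {x y z : Ω} => sameType_one hD hs hT hpq k (x := x) (y := y) (z := z)
  have h2 := fun (k k' : κ) {x y : Ω} => sameType_two hD hs hT hpq k k' (x := x) (y := y)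
  have h3 := fun (k k' k'' : κ) {x : Ω} => sameType_three hD hs hT hpq k k' k'' (x := x)
  rcases hw with ⟨k₀, rfl, rfl⟩ | ⟨rfl, hw⟩ <;> rcases hx with ⟨k₁, rfl, rfl⟩ | ⟨rfl, hx⟩ <;>
  rcases hy with ⟨k₂, rfl, rfl⟩ | ⟨rfl, hy⟩ <;> rcases hz with ⟨k₃, rfl, rfl⟩ | ⟨rfl, hz⟩
  · exact (hs.sameType hpq (.moving s p q k₀) (.moving s p q k₁) (.moving s p q k₂)
      (.moving s p q k₃)).1
  · exact (h3 k₀ k₁ k₂ hz).1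
  · exact ((h3 k₀ k₁ k₃ hy).perm₃ hD).1
  · exact (h2 k₀ k₁ hy hz).1
  · exact (((h3 k₀ k₂ k₃ hx).perm₃ hD).perm₂ hD).1
  · exact ((h2 k₀ k₂ hx hz).perm₂ hD).1
  · exact (((h2 k₀ k₃ hx hy).perm₂ hD).perm₃ hD).1
  · exact (h1 k₀ hx hy hz).1
  · exact ((((h3 k₁ k₂ k₃ hw).perm₃ hD).perm₂ hD).perm₁ hD).1
  · exact (((h2 k₁ k₂ hw hz).perm₂ hD).perm₁ hD).1
  · exact ((((h2 k₁ k₃ hw hy).perm₂ hD).perm₁ hD).perm₃ hD).1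
  · exact ((h1 k₁ hw hy hz).perm₁ hD).1
  · exact (((((h2 k₂ k₃ hw hx).perm₂ hD).perm₁ hD).perm₃ hD).perm₂ hD).1
  · exact (((h1 k₂ hw hx hz).perm₁ hD).perm₂ hD).1
  · exact ((((h1 k₃ hw hx hy).perm₁ hD).perm₂ hD).perm₃ hD).1
  · rfl

end Shift

/-! ### The node splitting given by a petaled sequence -/

section NodeSplitting

variable {Ω I : Type*} {D : Ω → Ω → Ω → Ω → Prop} {a : I → Ω}

variable (D) in
/-- The path between `x` and `y` avoids the node given by the petaled sequence `a`. -/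
def SameSector (a : I → Ω) (x y : Ω) : Prop := ∃ i j, i ≠ j ∧ D x y (a i) (a j)

theorem SameSector.symm (hD : IsDRelation D) {x y : Ω} (h : SameSector D a x y) :
    SameSector D a y x := by
  obtain ⟨i, j, hij, h⟩ := h
  exact ⟨i, j, hij, hD.swap_left h⟩

theorem SameSector.rel (hD : IsDRelation D) {x y : Ω} (h : SameSector D a x y) {k l : I}
    (hk : ¬ Near D a x k ∧ ¬ Near D a y k) (hl : ¬ Near D a x l ∧ ¬ Near D a y l) (hkl : k ≠ l) :
    D x y (a k) (a l) := by
  have step : ∀ i j k, i ≠ j → i ≠ k → ¬ Near D a x k → ¬ Near D a y k → D x y (a i) (a j) →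
      D x y (a i) (a k) := by
    intro i j k hij hik hx hy h
    by_cases hjk : j = k
    · exact hjk ▸ h
    refine (hD.d3 _ _ _ _ h (a k)).resolve_left fun g => hy ?_
    exact ⟨i, j, Ne.symm hik, Ne.symm hjk, hij, hD.swap_left g⟩
  obtain ⟨i, j, hij, h⟩ := h
  by_cases hik : i = k
  · subst hik
    exact step _ _ _ hij hkl hl.1 hl.2 h
  · have h1 := step _ _ _ hij hik hk.1 hk.2 h
    exact step _ _ _ (Ne.symm hik) hkl hl.1 hl.2 (hD.swap_right h1)

/-- Every point lies in the sector of at most one entry, so finitely many points leave infinitely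
many entries free to serve as reference points. -/
theorem exists_pair_not_near [Infinite I] (hD : IsDRelation D) (ha : IsPetaled D a)
    (t : Finset Ω) : ∃ k l, k ≠ l ∧ ∀ x ∈ t, ¬ Near D a x k ∧ ¬ Near D a x l := by
  classical
  have hfin : (⋃ x ∈ t, {i | Near D a x i}).Finite :=
    t.finite_toSet.biUnion fun x _ => finite_setOf_near hD ha x
  obtain ⟨k, -, hk⟩ := (Set.infinite_univ (α := I)).exists_notMem_finite hfin
  obtain ⟨l, -, hl⟩ := (Set.infinite_univ (α := I)).exists_notMem_finite
    (hfin.union (Set.finite_singleton k))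
  simp only [Set.mem_union, Set.mem_iUnion, Set.mem_ofPred_eq, Set.mem_singleton_iff, not_or,
    not_exists] at hk hl
  exact ⟨k, l, Ne.symm hl.2, fun x hx => ⟨hk x hx, hl.1 x hx⟩⟩

theorem SameSector.refl [Infinite I] (hD : IsDRelation D) (ha : IsPetaled D a) (x : Ω) :
    SameSector D a x x := by
  obtain ⟨k, l, hkl, h⟩ := exists_pair_not_near hD ha {x}
  have h := h x (by simp)
  refine ⟨k, l, hkl, hD.flip (hD.d4 _ _ _ ?_ ?_)⟩ <;> rintro rfl
  · exact h.1 (.self hD ha k)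
  · exact h.2 (.self hD ha l)

theorem SameSector.trans [Infinite I] (hD : IsDRelation D) (ha : IsPetaled D a) {x y z : Ω}
    (h : SameSector D a x y) (h' : SameSector D a y z) : SameSector D a x z := by
  classical
  obtain ⟨k, l, hkl, hn⟩ := exists_pair_not_near hD ha {x, y, z}
  simp only [Finset.mem_insert, Finset.mem_singleton, forall_eq_or_imp, forall_eq] at hn
  have h1 := h.rel hD ⟨hn.1.1, hn.2.1.1⟩ ⟨hn.1.2, hn.2.1.2⟩ hkl
  have h2 := h'.rel hD ⟨hn.2.1.1, hn.2.2.1⟩ ⟨hn.2.1.2, hn.2.2.2⟩ hkl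
  exact ⟨k, l, hkl, hD.flip (hD.trans (hD.flip (hD.swap_left h1)) (hD.flip h2))⟩

/-- The equivalence relation of lying in the same sector of the node given by `a`. -/
def sectorSetoid [Infinite I] (hD : IsDRelation D) (ha : IsPetaled D a) : Setoid Ω where
  r := SameSector D a
  iseqv := ⟨SameSector.refl hD ha, SameSector.symm hD, SameSector.trans hD ha⟩

theorem not_sameSector_entries (hD : IsDRelation D) (ha : IsPetaled D a) {i j : I} (hij : i ≠ j) :
    ¬ SameSector D a (a i) (a j) := by
  rintro ⟨k, l, hkl, h⟩
  have ne : ∀ {i j}, a i ≠ a j → i ≠ j := fun h g => h (congrArg a g)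
  exact ha.2 i j k l hij (ne (hD.ne_of_rel h)) (ne (hD.ne_of_rel (hD.swap_right h)))
    (ne (hD.ne_of_rel (hD.swap_left h))) (ne (hD.ne_of_rel (hD.swap_left (hD.swap_right h)))) hkl h

theorem rel_of_sameSector [Infinite I] (hD : IsDRelation D) (ha : IsPetaled D a) {w x y z : Ω}
    (h : SameSector D a w x) (hy : ¬ SameSector D a w y) (hz : ¬ SameSector D a w z) :
    D w x y z := by
  classical
  obtain ⟨k, l, hkl, hn⟩ := exists_pair_not_near hD ha {w, x}
  simp only [Finset.mem_insert, Finset.mem_singleton, forall_eq_or_imp, forall_eq] at hn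
  have h1 := h.rel hD ⟨hn.1.1, hn.2.1⟩ ⟨hn.1.2, hn.2.2⟩ hkl
  have h2 := (hD.d3' h1 y).resolve_left fun g => hy ⟨k, l, hkl, g⟩
  have h3 := (hD.d3' h1 z).resolve_left fun g => hz ⟨k, l, hkl, g⟩
  exact hD.trans h2 h3

/-- (D3) brings in reference entries `a k` and `a l`, until either a pair shares a sector or
`not_rel_of_not_near` is violated. This is stronger than the splitting axiom, which assumes four
different sectors. -/
theorem not_rel_of_not_sameSector [Infinite I] (hD : IsDRelation D) (ha : IsPetaled D a)
    {w x y z : Ω} (hwx : ¬ SameSector D a w x) (hyz : ¬ SameSector D a y z) : ¬ D w x y z := by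
  classical
  intro h
  obtain ⟨k, l, hkl, hn⟩ := exists_pair_not_near hD ha {w, x, y, z}
  simp only [Finset.mem_insert, Finset.mem_singleton, forall_eq_or_imp, forall_eq] at hn
  obtain ⟨r, hr⟩ := Infinite.exists_notMem_finset {k, l}
  simp only [Finset.mem_insert, Finset.mem_singleton, not_or] at hr
  have key : ∀ u v, ¬ Near D a u k ∧ ¬ Near D a u l → ¬ Near D a v k ∧ ¬ Near D a v l →
      ¬ D (a k) u (a l) v := fun u v hu hv =>
    not_rel_of_not_near hD hkl (Ne.symm hr.1) (Ne.symm hr.2) hu.1 hv.2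
  have key' : ∀ w x z, ¬ SameSector D a w x → ¬ Near D a x k ∧ ¬ Near D a x l →
      ¬ Near D a z k ∧ ¬ Near D a z l → ¬ D w x z (a k) := fun w x z hwx hx hz h =>
    (hD.d3 _ _ _ _ (hD.swap_right h) (a l)).elim (fun g => key _ _ hz hx (hD.flip g))
      fun g => hwx ⟨k, l, hkl, g⟩
  rcases hD.d3 _ _ _ _ (hD.swap_right h) (a k) with h1 | h1
  · exact key' z y x (fun g => hyz (g.symm hD)) hn.2.2.1 hn.2.1 (hD.swap_right (hD.flip h1))
  · exact key' w x z hwx hn.2.1 hn.2.2.2 h1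

/-- The forward direction works in an arbitrary node splitting separating the entries; the converse
exhibits one, the classes of `sectorSetoid`. Uniqueness of the node splitting is therefore not
needed. -/
theorem mem_petaledHull_iff [Infinite I] (hD : IsDRelation D) (ha : IsPetaled D a) {x : Ω} :
    x ∈ petaledHull D a ↔ ∃ i, Near D a x i := by
  classical
  constructor
  · rintro ⟨C, hC, hsep, S, hS, hxS, i, hiS⟩
    refine ⟨i, ?_⟩
    obtain ⟨j, hj⟩ := Infinite.exists_notMem_finset {i}
    obtain ⟨k, hk⟩ := Infinite.exists_notMem_finset {i, j}
    simp only [Finset.mem_insert, Finset.mem_singleton, not_or] at hj hk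
    obtain ⟨S', hS', hSi⟩ := hsep i
    have hi' : a i ∈ S' := (hSi.symm ▸ Set.mem_singleton (a i) : a i ∈ S' ∩ Set.range a).1
    obtain rfl : S = S' := (hC.1.isPartition.2 (a i)).unique ⟨hS, hiS⟩ ⟨hS', hi'⟩
    have hout : ∀ j, j ≠ i → a j ∉ S := fun j hj h =>
      hj (ha.1 (Set.mem_singleton_iff.1 (hSi ▸ ⟨h, Set.mem_range_self j⟩)))
    exact ⟨j, k, Ne.symm hj, Ne.symm hk.1, Ne.symm hk.2,
      hC.1.same S hS x hxS (a i) hiS (a j) (hout j hj) (a k) (hout k hk.1)⟩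
  · rintro ⟨i, hi⟩
    have hmem : ∀ S ∈ (sectorSetoid hD ha).classes, ∀ x ∈ S, ∀ y,
        y ∈ S ↔ SameSector D a x y := by
      rintro _ ⟨z, rfl⟩ x hx y
      exact ⟨fun hy => SameSector.trans hD ha hx (SameSector.symm hD hy),
        fun hy => (SameSector.symm hD hy).trans hD ha hx⟩
    have hne : ∀ S ∈ (sectorSetoid hD ha).classes, ∀ S' ∈ (sectorSetoid hD ha).classes,
        S ≠ S' → ∀ x ∈ S, ∀ y ∈ S', ¬ SameSector D a x y := by
      intro S hS S' hS' hSS x hx y hy hxy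
      exact hSS (Setoid.eq_of_mem_classes hS ((hmem S hS x hx y).2 hxy) hS' hy)
    have hclass : ∀ x, {y | SameSector D a y x} ∈ (sectorSetoid hD ha).classes :=
      fun x => ⟨x, rfl⟩
    have hcard : 2 < (sectorSetoid hD ha).classes.encard := by
      have : (sectorSetoid hD ha).classes.Infinite := by
        refine Set.infinite_of_injective_forall_mem
          (f := fun i => {y | SameSector D a y (a i)}) (fun i j hij => ?_) fun i => hclass (a i)
        by_contra hne
        have : a i ∈ {y | SameSector D a y (a j)} := by
          rw [← show {y | SameSector D a y (a i)} = {y | SameSector D a y (a j)} from hij]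
          exact SameSector.refl hD ha (a i)
        exact not_sameSector_entries hD ha hne this
      rw [this.encard_eq]
      exact ENat.natCast_lt_top 2
    refine ⟨(sectorSetoid hD ha).classes, ⟨⟨Setoid.isPartition_classes _, hcard.le, ?_, ?_⟩,
      hcard⟩, fun j => ⟨_, hclass (a j), ?_⟩, _, hclass (a i), ?_, i, SameSector.refl hD ha (a i)⟩
    · intro S hS w hw x hx y hy z hz
      exact rel_of_sameSector hD ha ((hmem S hS w hw x).1 hx)
        (fun h => hy ((hmem S hS w hw y).2 h)) (fun h => hz ((hmem S hS w hw z).2 h))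
    · intro S₁ h₁ S₂ h₂ S₃ h₃ S₄ h₄ h12 _ _ _ _ h34 w hw x hx y hy z hz
      exact not_rel_of_not_sameSector hD ha (hne _ h₁ _ h₂ h12 w hw x hx)
        (hne _ h₃ _ h₄ h34 y hy z hz)
    · ext y
      constructor
      · rintro ⟨hy, k, rfl⟩
        by_contra hkj
        exact not_sameSector_entries hD ha (fun h => hkj (congrArg a h)) hy
      · rintro rfl
        exact ⟨SameSector.refl hD ha (a j), j, rfl⟩
    · obtain ⟨j, k, _, _, hjk, h⟩ := hi
      exact ⟨j, k, hjk, h⟩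

end NodeSplitting

/-! ### Position of a point relative to the hull -/

section Hull

variable {Ω I : Type*} {D : Ω → Ω → Ω → Ω → Prop} [LinearOrder I] {a : I → Ω}

/-- Outside `hull₁` and `hull₂`, the point has a side at each position between `l` and `r`. Being
right of `p` and left of `q` is membership in `hull₃`; left of `p` and right of `q` contradicts
monotonicity. -/
theorem sides_of_notMem_monotonicHull (hD : IsDRelation D) (ha : IsMonotonic D a) {x : Ω}
    (hx : x ∉ monotonicHull D a) {l p q r : I} (hlp : l < p) (hpq : p < q) (hqr : q < r) :
    (D (a l) (a p) x (a r) ∧ D (a l) (a q) x (a r)) ∨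
      (D (a l) x (a p) (a r) ∧ D (a l) x (a q) (a r)) := by
  simp only [monotonicHull, Set.mem_union, not_or] at hx
  obtain ⟨⟨⟨-, h1⟩, h2⟩, h3⟩ := hx
  have key : ∀ p, l < p → p < r → D (a l) (a p) x (a r) ∨ D (a l) x (a p) (a r) := by
    intro p hlp hpr
    by_contra! h
    refine h2 ⟨l, p, r, hlp, hpr, fun g => h.1 (hD.swap_right g), fun g => h1 ?_, h.2⟩
    exact ⟨l, p, r, hlp, hpr, g⟩
  rcases key p hlp (hpq.trans hqr) with g | g <;> rcases key q (hlp.trans hpq) hqr with g' | g'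
  · exact .inl ⟨g, g'⟩
  · exact (h3 ⟨l, p, q, r, hlp, hpq, hqr, g', g⟩).elim
  · exfalso
    have g1 := (hD.d3' g (a q)).resolve_left (hD.not_cross (ha.2 _ _ _ _ hlp hpq hqr))
    have g2 := (hD.d3' g' (a p)).resolve_left (hD.not_cross g)
    exact hD.not_cross (hD.swap_right g1) g2
  · exact .inr ⟨g, g'⟩

variable [NoMaxOrder I]

theorem outside_of_notMem_hull {n : ℕ} {s : I → Fin n → Ω} (hD : IsDRelation D) {x : Ω}
    (hx : x ∉ hull D s) (hI : Nonempty I) : Outside D s x := by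
  have hinf : Infinite I := NoMaxOrder.infinite
  have hx' : ∀ k, x ∉ singleHull D (fun i => s i k) := fun k h => hx (Set.mem_iUnion.2 ⟨k, h⟩)
  have hc : ∀ k, Function.Injective (fun i => s i k) → ¬ IsConstant (fun i => s i k) := by
    intro k hk h
    obtain ⟨i⟩ := hI
    obtain ⟨j, hj⟩ := exists_gt i
    exact hj.ne (hk (h i j))
  constructor
  · intro k hk i hi
    refine hx' k ?_
    rw [singleHull, if_neg (hc k hk.1), if_pos hk]
    exact (mem_petaledHull_iff hD hk).2 ⟨i, hi⟩
  · intro k hk l p q r hlp hpq hqr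
    have hp : ¬ IsPetaled D (fun i => s i k) := fun h =>
      h.2 l p q r hlp.ne (hlp.trans hpq).ne (hlp.trans (hpq.trans hqr)).ne hpq.ne
        (hpq.trans hqr).ne hqr.ne (hk.2 _ _ _ _ hlp hpq hqr)
    have := hx' k
    rw [singleHull, if_neg (hc k hk.1), if_neg hp, if_pos hk] at this
    exact sides_of_notMem_monotonicHull hD hk this hlp hpq hqr

variable [NoMinOrder I]

/-- Uniformity would put `x` into two sectors of a petaled sequence. For a monotonic one it would
make `x` equal to all entries, or transport the witness of a `hull` clause to another triple, where
it clashes with (D2) or with (D3) applied to four increasing entries. -/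
theorem notMem_singleHull (hD : IsDRelation D) {x : Ω} (heq : ∀ i j, a i = x → a j = x)
    (hrel : ∀ f g : Fin 3 → I, (∀ u v, f u < f v ↔ g u < g v) →
      D (a (f 0)) (a (f 1)) (a (f 2)) x → D (a (g 0)) (a (g 1)) (a (g 2)) x) :
    x ∉ singleHull D a := by
  have hmono : ∀ i j k i' j' k' : I, i < j → j < k → i' < j' → j' < k' → ∀ u v,
      ![i, j, k] u < ![i, j, k] v ↔ ![i', j', k'] u < ![i', j', k'] v := by
    have mono : ∀ i j k : I, i < j → j < k → StrictMono ![i, j, k] := fun i j k h1 h2 =>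
      Fin.strictMono_iff_lt_succ.2 fun x => by fin_cases x <;> simpa
    intro i j k i' j' k' h1 h2 h1' h2' u v
    rw [(mono i j k h1 h2).lt_iff_lt, (mono i' j' k' h1' h2').lt_iff_lt]
  have h₁ : ∀ i j k i' j' k', i < j → j < k → i' < j' → j' < k' →
      D (a i) (a j) (a k) x → D (a i') (a j') (a k') x :=
    fun i j k i' j' k' h1 h2 h1' h2' => hrel _ _ (hmono i j k i' j' k' h1 h2 h1' h2')
  have h₂ : ∀ i j k i' j' k', i < j → j < k → i' < j' → j' < k' →
      D (a i) (a k) (a j) x → D (a i') (a k') (a j') x :=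
    fun i j k i' j' k' h1 h2 h1' h2' => hrel
      (![i, j, k] ∘ (![0, 2, 1] : Fin 3 → Fin 3)) (![i', j', k'] ∘ (![0, 2, 1] : Fin 3 → Fin 3))
      fun u v => hmono i j k i' j' k' h1 h2 h1' h2' _ _
  have h₃ : ∀ i j k i' j' k', i < j → j < k → i' < j' → j' < k' →
      D (a i) x (a j) (a k) → D (a i') x (a j') (a k') := fun i j k i' j' k' h1 h2 h1' h2' h =>
    -- `hrel` wants `x` in last place: the relation is read as `D(a j, a k; a i, x)`, with the
    -- indices permuted accordingly.
    hD.flip (hrel (![i, j, k] ∘ (![1, 2, 0] : Fin 3 → Fin 3))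
      (![i', j', k'] ∘ (![1, 2, 0] : Fin 3 → Fin 3))
      (fun u v => hmono i j k i' j' k' h1 h2 h1' h2' _ _) (hD.flip h))
  intro hx
  unfold singleHull at hx
  split_ifs at hx with hc hp hm
  · exact hx
  · have hI : Nonempty I := by
      by_contra h
      exact hc fun i => (h ⟨i⟩).elim
    have hinf : Infinite I := NoMaxOrder.infinite
    obtain ⟨i, hi⟩ := (mem_petaledHull_iff hD hp).1 hx
    obtain ⟨i', hi'⟩ := exists_lt i
    obtain ⟨j, hj⟩ := exists_gt i
    obtain ⟨k, hk⟩ := exists_gt j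
    have h1 := hi.rel hD hp hj.ne (hj.trans hk).ne hk.ne
    have h2 := h₃ _ _ _ _ _ _ hj hk (hi'.trans hj) hk (hD.swap_left h1)
    exact hi'.ne (Near.unique hD hp ⟨j, k, (hi'.trans hj).ne, (hi'.trans (hj.trans hk)).ne, hk.ne,
      hD.swap_left h2⟩ hi)
  · obtain ((⟨i, rfl⟩ | ⟨i, j, k, hij, hjk, h⟩) | ⟨i, j, k, hij, hjk, h1, h2, h3⟩) |
      ⟨i, j, k, l, hij, hjk, hkl, h, h'⟩ := hx
    · exact hc fun j k => (heq i j rfl).trans (heq i k rfl).symm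
    · obtain ⟨l, hl⟩ := exists_gt k
      have g1 := h₂ _ _ _ _ _ _ hij hjk hjk hl h
      rcases hD.d3 _ _ _ _ (hm.2 i j k l hij hjk hl) x with g | g
      · exact hD.not_cross (hD.swap_right (hD.swap_left g)) (hD.swap_right g1)
      · exact hD.not_cross g h
    · obtain ⟨l, hl⟩ := exists_gt k
      rcases hD.d3 _ _ _ _ (hm.2 i j k l hij hjk hl) x with g | g
      · exact h3 (h₃ _ _ _ _ _ _ hjk hl hij hjk (hD.swap_left g))
      · exact h1 g
    · exact hD.not_cross (h₃ _ _ _ _ _ _ (hij.trans hjk) hkl hij (hjk.trans hkl) h) h'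
  · exact hx

end Hull

/-! ### From increasing tuples of indices to arbitrary order types -/

section Logic

variable {I : Type*} [LinearOrder I]

/-- Enumerate the image of `f` increasingly and let `g` follow along preimages. Relabelling by the
common `σ` then covers repeated and unordered indices. -/
theorem exists_strictMono_comp {r : ℕ} (f g : Fin r → I) (h : ∀ x y, f x < f y ↔ g x < g y) :
    ∃ (m : ℕ) (i j : Fin m → I) (σ : Fin r → Fin m),
      StrictMono i ∧ StrictMono j ∧ (∀ x, f x = i (σ x)) ∧ ∀ x, g x = j (σ x) := by
  classical
  have heq : ∀ x y, f x = f y → g x = g y := fun x y hxy =>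
    le_antisymm (not_lt.1 fun h' => ((h y x).2 h').ne hxy.symm)
      (not_lt.1 fun h' => ((h x y).2 h').ne hxy)
  set F := Finset.univ.image f
  have hmem : ∀ x, f x ∈ F := fun x => Finset.mem_image_of_mem f (Finset.mem_univ x)
  let e := F.orderIsoOfFin rfl
  have hpre : ∀ y, ∃ x, f x = e y := fun y => by
    obtain ⟨x, -, hx⟩ := Finset.mem_image.1 (e y).2
    exact ⟨x, hx⟩
  choose τ hτ using hpre
  refine ⟨F.card, fun y => e y, fun y => g (τ y), fun x => e.symm ⟨f x, hmem x⟩, ?_, ?_, ?_, ?_⟩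
  · exact fun y z hyz => e.strictMono hyz
  · intro y z hyz
    refine (h _ _).1 ?_
    rw [hτ, hτ]
    exact e.strictMono hyz
  · intro x
    simp
  · intro x
    refine heq _ _ ?_
    rw [hτ]
    simp

variable {L : Language} {M : Type*} [L.Structure M] {n : ℕ} {s : I → Fin n → M}

theorem QFIndiscernible.realize_iff (hs : QFIndiscernible L s) {r : ℕ}
    {φ : L.Formula (Fin r × Fin n)} (hφ : φ.IsQF) {f g : Fin r → I}
    (h : ∀ x y, f x < f y ↔ g x < g y) :
    φ.Realize (fun p => s (f p.1) p.2) ↔ φ.Realize (fun p => s (g p.1) p.2) := by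
  obtain ⟨m, i, j, σ, hi, hj, hf, hg⟩ := exists_strictMono_comp f g h
  have := hs m (φ.relabel (Prod.map σ id)) (hφ.relabel _) i j hi hj
  rw [Language.Formula.realize_relabel, Language.Formula.realize_relabel] at this
  convert this using 2
  · funext p
    simp [hf]
  · funext p
    simp [hg]

theorem Indiscernible.qf (hs : Indiscernible L s) : QFIndiscernible L s :=
  fun m φ _ => hs m φ

end Logic

/-! ### Translation between formulas and relations among entries -/

section Entries

/-- The symbol `D`. -/
def dSymb (ι : Type*) : (lang ι).Relations 4 := (Rel.D : Rel ι 4)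

/-- The symbol for the predicate with index `c`. -/
def colorSymb {ι : Type*} (c : ι) : (lang ι).Relations 1 := (Rel.color c : Rel ι 1)

variable {ι Ω I : Type*} [(lang ι).Structure Ω] [LinearOrder I] {n : ℕ} {s : I → Fin n → Ω}

theorem QFIndiscernible.relIndiscernible (hs : QFIndiscernible (lang ι) s) :
    RelIndiscernible (dRel ι) s := by
  intro f g h k
  let t : Fin 4 → (lang ι).Term (Fin 4 × Fin n) := fun x => .var (x, k x)
  have key : ∀ v : Fin 4 × Fin n → Ω,
      ((dSymb ι).formula t).Realize v ↔
      dRel ι (v (0, k 0)) (v (1, k 1)) (v (2, k 2)) (v (3, k 3)) := by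
    intro v
    refine Language.Formula.realize_rel.trans (iff_of_eq ?_)
    change Language.Structure.RelMap (dSymb ι) _ = Language.Structure.RelMap (dSymb ι) _
    refine congrArg _ ?_
    funext x
    fin_cases x <;> rfl
  have := hs.realize_iff (φ := (dSymb ι).formula t)
    (.of_isAtomic (.rel _ _)) h
  rwa [key, key] at this

theorem QFIndiscernible.color_iff (hs : QFIndiscernible (lang ι) s) (c : ι) (p q : I)
    (k : Fin n) :
    Language.Structure.RelMap (colorSymb c) ![s p k] ↔
      Language.Structure.RelMap (colorSymb c) ![s q k] := by
  let t : Fin 1 → (lang ι).Term (Fin 1 × Fin n) := fun x => .var (x, k)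
  have key : ∀ v : Fin 1 × Fin n → Ω,
      ((colorSymb c).formula t).Realize v ↔
      Language.Structure.RelMap (colorSymb c) ![v (0, k)] := by
    intro v
    refine Language.Formula.realize_rel.trans <| iff_of_eq (congrArg _ ?_)
    funext x
    fin_cases x
    rfl
  have := hs.realize_iff
    (φ := (colorSymb c).formula t)
    (.of_isAtomic (.rel _ _)) (f := fun _ => p) (g := fun _ => q) (by simp)
  rwa [key, key] at this

theorem QFIndiscernible.eq_iff {L : Language} {M : Type*} [L.Structure M] {s : I → Fin n → M}
    (hs : QFIndiscernible L s) {i j i' j' : I} (h : i < j ↔ i' < j') (h' : j < i ↔ j' < i')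
    (k l : Fin n) : s i k = s j l ↔ s i' k = s j' l := by
  have := hs.realize_iff (φ := Language.Term.equal (.var (0, k)) (.var (1, l)))
    (.of_isAtomic (.equal _ _)) (f := ![i, j]) (g := ![i', j']) (by
      intro x y
      fin_cases x <;> fin_cases y <;> simp [h, h'])
  simpa [Language.Formula.realize_equal] using this

variable {B : Set Ω}

theorem WeaklyIndiscernibleOver.eq_iff (hs : WeaklyIndiscernibleOver (lang ι) B s) {b : Ω}
    (hb : b ∈ B) (i j : I) (k : Fin n) : s i k = b ↔ s j k = b := by
  have := QFIndiscernible.realize_iff hs (φ := Language.Term.equal (.var (0, k))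
    (Language.Constants.term ((lang ι).con (⟨b, hb⟩ : B))))
    (.of_isAtomic (.equal _ _)) (f := ![i]) (g := ![j]) (by
      intro x y
      fin_cases x; fin_cases y; simp)
  simpa [Language.Formula.realize_equal] using this

theorem WeaklyIndiscernibleOver.rel_iff (hs : WeaklyIndiscernibleOver (lang ι) B s) {b : Ω}
    (hb : b ∈ B) (k : Fin n) (f g : Fin 3 → I) (h : ∀ x y, f x < f y ↔ g x < g y) :
    dRel ι (s (f 0) k) (s (f 1) k) (s (f 2) k) b ↔
      dRel ι (s (g 0) k) (s (g 1) k) (s (g 2) k) b := by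
  let t : Fin 4 → ((lang ι).withConstants B).Term (Fin 3 × Fin n) :=
    ![.var (0, k), .var (1, k), .var (2, k),
      Language.Constants.term ((lang ι).con (⟨b, hb⟩ : B))]
  let R : ((lang ι).withConstants B).Relations 4 :=
    ((lang ι).lhomWithConstants B).onRelation (dSymb ι)
  have key : ∀ v : Fin 3 × Fin n → Ω, (R.formula t).Realize v ↔
      dRel ι (v (0, k)) (v (1, k)) (v (2, k)) b := by
    intro v
    refine Language.Formula.realize_rel.trans (iff_of_eq ?_)
    refine (Language.LHom.map_onRelation ((lang ι).lhomWithConstants B) (dSymb ι) _).trans ?_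
    change Language.Structure.RelMap (dSymb ι) _ = Language.Structure.RelMap (dSymb ι) _
    refine congrArg _ ?_
    funext x
    fin_cases x <;> simp [t]
  have := QFIndiscernible.realize_iff hs (φ := R.formula t) (.of_isAtomic (.rel _ _)) h
  rwa [key, key] at this

theorem WeaklyIndiscernibleOver.disjoint_hull [NoMinOrder I] [NoMaxOrder I]
    (hD : IsDRelation (dRel ι (Ω := Ω))) (hs : WeaklyIndiscernibleOver (lang ι) B s) :
    Disjoint B (hull (dRel ι) s) := by
  refine Set.disjoint_left.2 fun b hb hbs => ?_
  obtain ⟨k, hk⟩ := Set.mem_iUnion.1 hbs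
  exact notMem_singleHull hD (fun i j => (hs.eq_iff hb i j k).1)
    (fun f g h => (hs.rel_iff hb k f g h).1) hk

/-- An entry is near itself, and it cannot be on a side of itself because `D` never holds with a
point occurring in both pairs. -/
theorem Outside.ne [NoMinOrder I] [NoMaxOrder I] {D : Ω → Ω → Ω → Ω → Prop} (hD : IsDRelation D)
    {b : Ω} (hb : Outside D s b) {k : Fin n}
    (hk : IsPetaled D (fun i => s i k) ∨ IsMonotonic D (fun i => s i k)) (i : I) : s i k ≠ b := by
  rintro rfl
  have hI : Nonempty I := ⟨i⟩
  have hI' : Infinite I := NoMaxOrder.infinite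
  rcases hk with hk | hk
  · exact hb.petaled k hk i (Near.self hD hk i)
  · obtain ⟨l, hl⟩ := exists_lt i
    obtain ⟨q, hq⟩ := exists_gt i
    obtain ⟨r, hr⟩ := exists_gt q
    rcases hb.monotonic k hk l i q r hl hq hr with h | h
    · exact hD.ne_of_rel (hD.swap_left h.1) rfl
    · exact hD.ne_of_rel (hD.swap_left h.1) rfl

variable [NoMinOrder I] [NoMaxOrder I]

/-- Quantifier-free formulas with parameters outside the hull are invariant under replacing one
index. -/
theorem realize_iff_of_shift (hD : IsDRelation (dRel ι (Ω := Ω)))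
    (hs : QFIndiscernible (lang ι) s)
    (hT : ∀ k, IsConstant (fun i => s i k) ∨ IsPetaled (dRel ι) (fun i => s i k) ∨
      IsMonotonic (dRel ι) (fun i => s i k))
    (hB : ∀ b ∈ B, Outside (dRel ι) s b) {p q : I} (hpq : p < q) {α : Type*} {v w : α → Ω}
    (hvw : ∀ x, (∃ k, v x = s p k ∧ w x = s q k) ∨
      (v x = w x ∧ ∃ i k, (i < p ∨ q < i) ∧ v x = s i k))
    {φ : ((lang ι).withConstants B).Formula α} (hφ : φ.IsQF) : φ.Realize v ↔ φ.Realize w := by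
  -- The only terms are variables and constants from `B`, so each value either moves from `s p k` to
  -- `s q k` or is fixed.
  have hterm : ∀ (t : ((lang ι).withConstants B).Term (α ⊕ Fin 0)) (xs : Fin 0 → Ω),
      (∃ k, t.realize (Sum.elim v xs) = s p k ∧ t.realize (Sum.elim w xs) = s q k) ∨
      (t.realize (Sum.elim v xs) = t.realize (Sum.elim w xs) ∧
        Fixed (dRel ι) s p q (t.realize (Sum.elim v xs))) := by
    intro t xs
    match t with
    | .var (.inl x) => exact (hvw x).imp id fun h => ⟨h.1, .inr h.2⟩
    | .var (.inr z) => exact z.elim0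
    | .func (l := 0) (.inr b) ts =>
      have h : ∀ u, (Language.Term.func (L := (lang ι).withConstants B) (l := 0) (.inr b) ts).realize
          u = ((b : B) : Ω) := fun _ => rfl
      rw [h, h]
      exact .inr ⟨rfl, .inl (hB _ b.2)⟩
    | .func (.inl f) ts => exact f.elim
    | .func (l := _ + 1) (.inr b) ts => exact b.elim
  -- A point outside the hull can equal an entry only in a constant component.
  have hmem : ∀ {k b}, s p k = b ∨ s q k = b → Outside (dRel ι) s b → s p k = b ∧ s q k = b := by
    intro k b h hb
    rcases hT k with hk | hk
    · have : s p k = s q k := hk p q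
      rw [this] at h ⊢
      simpa using h
    · exact (h.elim (hb.ne hD hk p) (hb.ne hD hk q)).elim
  have heq : ∀ {x x' y y' : Ω}, ((∃ k, x = s p k ∧ x' = s q k) ∨ (x = x' ∧ Fixed (dRel ι) s p q x)) →
      ((∃ k, y = s p k ∧ y' = s q k) ∨ (y = y' ∧ Fixed (dRel ι) s p q y)) →
      (x = y ↔ x' = y') := by
    have aux : ∀ {k x}, Fixed (dRel ι) s p q x → (s p k = x ↔ s q k = x) := by
      rintro k x (hx | ⟨i, k', hi, rfl⟩)
      · exact ⟨fun h => (hmem (.inl h) hx).2, fun h => (hmem (.inr h) hx).1⟩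
      · refine hs.eq_iff ?_ ?_ k k' <;> grind
    rintro x x' y y' (⟨k, rfl, rfl⟩ | ⟨rfl, hx⟩) (⟨k', rfl, rfl⟩ | ⟨rfl, hy⟩)
    · exact hs.eq_iff (by simp) (by simp) k k'
    · exact aux hy
    · rw [eq_comm, aux hx, eq_comm]
    · rfl
  have hrel : ∀ {l : ℕ} (R : ((lang ι).withConstants B).Relations l) (u u' : Fin l → Ω),
      (∀ x, (∃ k, u x = s p k ∧ u' x = s q k) ∨ (u x = u' x ∧ Fixed (dRel ι) s p q (u x))) →
      (Language.Structure.RelMap R u ↔ Language.Structure.RelMap R u') := by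
    intro l R u u' hu
    match l, R with
    | _, .inr R => exact R.elim
    | 4, .inl .D =>
      have e : ∀ u : Fin 4 → Ω, Language.Structure.RelMap (L := (lang ι).withConstants B)
          (.inl (Rel.D : Rel ι 4)) u ↔ dRel ι (u 0) (u 1) (u 2) (u 3) := fun u => by
        change Language.Structure.RelMap (dSymb ι) u ↔ Language.Structure.RelMap (dSymb ι) _
        refine iff_of_eq (congrArg _ (funext fun x => ?_))
        fin_cases x <;> rfl
      exact (e u).trans ((rel_iff_of_shift hD hs.relIndiscernible hT hpq (hu 0) (hu 1) (hu 2)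
        (hu 3)).trans (e u').symm)
    | 1, .inl (.color c) =>
      have e : ∀ u : Fin 1 → Ω, Language.Structure.RelMap (L := (lang ι).withConstants B)
          (.inl (Rel.color c : Rel ι 1)) u ↔ Language.Structure.RelMap (colorSymb c) ![u 0] :=
        fun u => by
          change Language.Structure.RelMap (colorSymb c) u ↔ _
          refine iff_of_eq (congrArg _ (funext fun x => ?_))
          fin_cases x
          rfl
      rw [e, e]
      rcases hu 0 with ⟨k, h, h'⟩ | ⟨h, -⟩
      · rw [h, h']
        exact hs.color_iff c p q k
      · rw [h]
  unfold Language.Formula.Realize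
  induction hφ with
  | falsum => rfl
  | of_isAtomic h =>
    cases h with
    | equal t₁ t₂ =>
      simp only [Language.BoundedFormula.realize_bdEqual]
      exact heq (hterm t₁ _) (hterm t₂ _)
    | rel R ts =>
      simp only [Language.BoundedFormula.realize_rel]
      exact hrel R _ _ fun x => hterm (ts x) _
  | imp _ _ h₁ h₂ =>
    simp only [Language.BoundedFormula.realize_imp]
    exact imp_congr h₁ h₂

end Entries

/-! ### Linking increasing tuples by single moves -/

section Chain

variable {ι Ω I : Type*} [(lang ι).Structure Ω] [LinearOrder I] [NoMinOrder I] [NoMaxOrder I]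
  {n : ℕ} {s : I → Fin n → Ω} {B : Set Ω}

theorem weaklyIndiscernibleOver_of_outside (hD : IsDRelation (dRel ι (Ω := Ω)))
    (hs : QFIndiscernible (lang ι) s)
    (hB : Nonempty I → ∀ b ∈ B, Outside (dRel ι) s b) : WeaklyIndiscernibleOver (lang ι) B s := by
  have hT : ∀ k, IsConstant (fun i => s i k) ∨ IsPetaled (dRel ι) (fun i => s i k) ∨
      IsMonotonic (dRel ι) (fun i => s i k) := fun k =>
    isConstant_or_isPetaled_or_isMonotonic hD
      (fun i j i' j' h h' => (hs.eq_iff (iff_of_true h h') (iff_of_false h.not_gt h'.not_gt) k k).1)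
      (fun f g h => hs.relIndiscernible f g h fun _ => k)
  intro m φ hφ
  have main : ∀ i K : Fin m → I, StrictMono i → StrictMono K → (∀ x y, i x < K y) →
      (φ.Realize (fun p => s (i p.1) p.2) ↔ φ.Realize (fun p => s (K p.1) p.2)) := by
    intro i K hi hK hiK
    -- From `c (t + 1)` to `c t` only position `t` moves, from `i t` to `K t`. Earlier positions
    -- stay below `i t` and later ones are already above `K t`, as the shift requires.
    let c : ℕ → Fin m → I := fun t x => if (x : ℕ) < t then i x else K x
    have step : ∀ t, φ.Realize (fun p => s (c (t + 1) p.1) p.2) ↔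
        φ.Realize (fun p => s (c t p.1) p.2) := by
      intro t
      by_cases ht : t < m
      · have hlt := hiK ⟨t, ht⟩ ⟨t, ht⟩
        refine realize_iff_of_shift hD hs hT (hB ⟨i ⟨t, ht⟩⟩) hlt (fun x => ?_) hφ
        obtain ⟨x, k⟩ := x
        rcases lt_trichotomy (x : ℕ) t with h | h | h
        · refine .inr ⟨by simp [c, h, h.trans (Nat.lt_succ_self t)], i x, k, .inl (hi h), ?_⟩
          simp [c, h.trans (Nat.lt_succ_self t)]
        · obtain rfl : x = ⟨t, ht⟩ := Fin.ext h
          exact .inl ⟨k, by simp [c], by simp [c]⟩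
        · have h' : ¬ (x : ℕ) < t + 1 := by omega
          refine .inr ⟨by simp [c, h.not_gt, h'], K x, k, .inr (hK h), ?_⟩
          simp [c, h']
      · have : c (t + 1) = c t := by
          funext x
          have := x.2
          simp [c, show (x : ℕ) < t + 1 by omega, show (x : ℕ) < t by omega]
        rw [this]
    have all : ∀ t, φ.Realize (fun p => s (c t p.1) p.2) ↔ φ.Realize (fun p => s (c 0 p.1) p.2) := by
      intro t
      induction t with
      | zero => rfl
      | succ t ih => exact (step t).trans ih
    have h1 := all m
    have e1 : c m = i := by funext x; simp [c]
    have e2 : c 0 = K := by funext x; simp [c]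
    rwa [e1, e2] at h1
  intro i j hi hj
  rcases Nat.eq_zero_or_pos m with rfl | hm
  · rw [Subsingleton.elim i j]
  obtain ⟨f, hf, hf0⟩ := Nat.exists_strictMono' (max (i ⟨m - 1, by omega⟩) (j ⟨m - 1, by omega⟩))
  -- `f 0` is the larger of the last indices of `i` and `j`; the offset puts all of `K` strictly
  -- beyond both tuples.
  let K : Fin m → I := fun x => f (x + 1)
  have hK : StrictMono K := fun x y h => hf (by simpa using h)
  have hlast : ∀ x : Fin m, x ≤ ⟨m - 1, by omega⟩ := fun x => Fin.le_def.2 (by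
    have := x.2
    simp only
    omega)
  have hfK : ∀ x, f 0 < K x := fun x => hf (Nat.succ_pos _)
  refine (main i K hi hK fun x y => ?_).trans (main j K hj hK fun x y => ?_).symm
  · exact ((hi.monotone (hlast x)).trans (le_max_left _ _)).trans_lt (hf0 ▸ hfK y)
  · exact ((hj.monotone (hlast x)).trans (le_max_right _ _)).trans_lt (hf0 ▸ hfK y)

theorem weaklyIndiscernibleOver_iff (hD : IsDRelation (dRel ι (Ω := Ω)))
    (hs : QFIndiscernible (lang ι) s) :
    WeaklyIndiscernibleOver (lang ι) B s ↔ Disjoint B (hull (dRel ι) s) :=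
  ⟨fun h => h.disjoint_hull hD, fun h => weaklyIndiscernibleOver_of_outside hD hs
    fun hI _ hb => outside_of_notMem_hull hD (Set.disjoint_left.1 h hb) hI⟩

end Chain

/-! ### Quantifier elimination with parameters -/

section QuantifierElimination

open Language

theorem isQF_constantsVarsEquiv_symm {L : Language} {α γ : Type*} {m : ℕ}
    {φ : L.BoundedFormula (γ ⊕ α) m} (hφ : φ.IsQF) :
    (BoundedFormula.constantsVarsEquiv.symm φ : L[[γ]].BoundedFormula α m).IsQF := by
  induction hφ with
  | falsum => exact .falsum
  | of_isAtomic h =>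
    cases h with
    | equal => exact .of_isAtomic (.equal _ _)
    | rel => exact .of_isAtomic (.rel _ _)
  | imp _ _ h₁ h₂ => exact .imp h₁ h₂

/-- With quantifier elimination, every formula with parameters is equivalent to a quantifier-free
one. -/
theorem HasQE.exists_isQF {L : Language} {M : Type*} [L.Structure M] [Nonempty M]
    (h : HasQE (L.completeTheory M)) {B : Set M} {α : Type*} (φ : (L.withConstants B).Formula α) :
    ∃ ψ : (L.withConstants B).Formula α, ψ.IsQF ∧ ∀ v : α → M, φ.Realize v ↔ ψ.Realize v := by
  classical
  -- Parameters are turned into variables. Only finitely many variables are free, and numbering them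
  -- by `e` gives a formula to which `HasQE` applies.
  let φ' : L.Formula (B ⊕ α) := BoundedFormula.constantsVarsEquiv φ
  let e := φ'.freeVarFinset.equivFin
  obtain ⟨ψ, hψ, hiff⟩ := h _ (φ'.restrictFreeVar e)
  let ψ' : L.Formula (B ⊕ α) := Formula.relabel (fun x => (e.symm x : B ⊕ α)) ψ
  refine ⟨BoundedFormula.constantsVarsEquiv.symm ψ',
    isQF_constantsVarsEquiv_symm (hψ.relabel _), fun v => ?_⟩
  have h1 : φ'.Realize (Sum.elim (fun b : B => ((L.con b : L[[B]].Constants) : M)) v) ↔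
      φ.Realize v := BoundedFormula.realize_constantsVarsEquiv
  have h2 : ψ'.Realize (Sum.elim (fun b : B => ((L.con b : L[[B]].Constants) : M)) v) ↔
      Formula.Realize (BoundedFormula.constantsVarsEquiv.symm ψ' : L[[B]].Formula α) v := by
    have := BoundedFormula.realize_constantsVarsEquiv (L := L) (M := M) (v := v) (xs := default)
      (φ := (BoundedFormula.constantsVarsEquiv.symm ψ' : L[[B]].BoundedFormula α 0))
    rwa [Equiv.apply_symm_apply] at this
  rw [← h1, ← h2]
  set u := Sum.elim (fun b : B => ((L.con b : L[[B]].Constants) : M)) v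
  have h3 : Formula.Realize (φ'.restrictFreeVar e) (u ∘ fun x => (e.symm x : B ⊕ α)) ↔
      φ'.Realize u := BoundedFormula.realize_restrictFreeVar u (by simp)
  have h4 : Formula.Realize (φ'.restrictFreeVar e) (u ∘ fun x => (e.symm x : B ⊕ α)) ↔
      ψ.Realize (u ∘ fun x => (e.symm x : B ⊕ α)) := by
    have := hiff.realize_boundedFormula M (v := u ∘ fun x => (e.symm x : B ⊕ α)) (xs := default)
    rwa [BoundedFormula.realize_iff] at this
  rw [← h3, h4, Formula.realize_relabel]

theorem HasQE.indiscernibleOver_iff {L : Language} {M I : Type*} [L.Structure M] [LinearOrder I]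
    (h : HasQE (L.completeTheory M)) {B : Set M} {n : ℕ} {s : I → Fin n → M} :
    IndiscernibleOver L B s ↔ WeaklyIndiscernibleOver L B s := by
  refine ⟨fun h => Indiscernible.qf h, fun hs m φ i j hi hj => ?_⟩
  -- `HasQE.exists_isQF` needs a nonempty structure; in an empty one all valuations coincide.
  rcases isEmpty_or_nonempty M with hM | hM
  · rw [Subsingleton.elim (fun p : Fin m × Fin n => s (i p.1) p.2) fun p => s (j p.1) p.2]
  · obtain ⟨ψ, hψ, hφψ⟩ := h.exists_isQF φ
    rw [hφψ, hφψ]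
    exact hs m ψ hψ i j hi hj

end QuantifierElimination

end DSet

theorem mainTheorem3 {ι Ω I : Type*} [(DSet.lang ι).Structure Ω]
    (hΩ : DSet.IsDRelation (DSet.dRel ι (Ω := Ω)))
    [LinearOrder I] [NoMinOrder I] [NoMaxOrder I]
    {n : ℕ} (s : I → Fin n → Ω) (hs : DSet.Indiscernible (DSet.lang ι) s) (B : Set Ω) :
    (DSet.WeaklyIndiscernibleOver (DSet.lang ι) B s ↔
      Disjoint B (DSet.hull (DSet.dRel ι) s)) ∧
    (DSet.HasQE ((DSet.lang ι).completeTheory Ω) →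
      (DSet.IndiscernibleOver (DSet.lang ι) B s ↔
        DSet.WeaklyIndiscernibleOver (DSet.lang ι) B s) ∧
      (DSet.IndiscernibleOver (DSet.lang ι) B s ↔
        Disjoint B (DSet.hull (DSet.dRel ι) s))) := by
  have hweak := DSet.weaklyIndiscernibleOver_iff (B := B) hΩ hs.qf
  exact ⟨hweak, fun hQE => ⟨hQE.indiscernibleOver_iff, hQE.indiscernibleOver_iff.trans hweak⟩⟩
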